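/- **Setting.** A \emph{network} is a finite directed graph $G=(V,E)$ without self-loops. A \emph{system} assigns to each $v\in V$ a CSP process $P_v$: a sequential program over local variables, built from assignments, output commands $P_w!e$, input commands $P_w?x$ (with static partner $w$), nondeterministic selections and nondeterministic repetitions, whose guards consist of a Boolean expression optionally followed by an input or output command. All variables start with the same default value. Communication is synchronous: matching output and input commands are executed jointly. A selection all of whose guards are false fails, and a repetition exits when all its guards are false; otherwise the process waits until it can enter an alternative. $G$ \emph{admits} the system if $(v,w)\in E$ whenever $P_v$ contains an output command to $P_w$ or $P_w$ contains an input command from $P_v$. The system is in $\mathrm{CSP}_{in}$ if no guard contains an output command. A \emph{computation} is a maximal (finite or infinite) sequence of valid computation steps from the initial state, each step being a local step of one process or a direct communication between two processes; it is \emph{properly terminated} if it is finite and at its end all processes have completed their programs. A system with communication graph $G$ is \emph{symmetric} if for every automorphism $\sigma$ of $G$ and every computation $C$ there is a computation $C'$ in which, for every $v\in V$, $P_{\sigma(v)}$ performs the same steps (assignments, evaluations of guards, inputs and outputs with their values) as $P_v$ in $C$, with all process names changed via $\sigma$. It is \emph{electoral} if all its computations are properly terminated and at termination the local variables $\mathit{leader}$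 of all processes contain the same process name. It \emph{pairwise synchronizes} $V$ if all its computations are properly terminated and contain, for all $a\neq b$ in $V$, at least one direct communication from $P_a$ to $P_b$ or from $P_b$ to $P_a$. **Theorem.** Let $G=(V,E)$ be a network such that 1. $G$ is strongly connected, i.e. for all $a,b\in V$ there is a directed path from $a$ to $b$; 2. $G$ is directly connected, i.e. for all $a\neq b$ in $V$, $(a,b)\in E$ or $(b,a)\in E$; 3. $G$ admits a symmetric electoral system in $\mathrm{CSP}_{in}$; 4. there is $v\in V$ such that $(v,a)\in E$ and $(a,v)\in E$ for all $a\in V\setminus\{v\}$. Then $G$ admits a symmetric system in $\mathrm{CSP}_{in}$ that pairwise synchronizes $V$. -/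

import Mathlib

universe u

namespace CSP

/-! ### Networks -/

/-- A communication graph (network) is a directed graph without self-loops. -/
def IsNetwork {V : Type u} (G : Digraph V) : Prop :=
  ∀ v, ¬ G.Adj v v

/-- Any two vertices are joined by directed paths in both directions. -/
def StronglyConnected {V : Type u} (G : Digraph V) : Prop :=
  ∀ a b, Relation.ReflTransGen G.Adj a b

/-- Any two distinct vertices are joined by an edge in at least one direction. -/
def DirectlyConnected {V : Type u} (G : Digraph V) : Prop :=
  ∀ a b, a ≠ b → G.Adj a b ∨ G.Adj b a

/-- A permutation of the vertices that maps edges to edges. -/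
def IsAutomorphism {V : Type u} (G : Digraph V) (σ : Equiv.Perm V) : Prop :=
  ∀ v w, G.Adj v w → G.Adj (σ v) (σ w)

/-! ### Data -/

/-- Data values: Booleans, integers, process names, and tuples of these. -/
inductive Val (V : Type u) : Type u
  | bool (b : Bool)
  | int (z : ℤ)
  | name (v : V)
  | pair (a b : Val V)

/-- Local variables: the variable `leader`, and a supply of further variables that may carry
process names as subscripts (as in `sync_w`). -/
inductive Var (V : Type u) : Type u
  | leader
  | other (id : ℕ) (subscripts : List V)
  deriving DecidableEq

/-- The contents of the local variables of one process. -/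
abbrev Store (V : Type u) : Type u := Var V → Val V

/-- Every variable initially holds the same default value, which contains no process name. -/
def Store.init {V : Type u} : Store V := fun _ => Val.int 0

/-! ### Programs

Expressions and Boolean expressions over the local variables are represented by the functions of
the store that they denote. Communication partners are static. -/

/-- The communication statement of a guard: input `P_w ? x` or output `P_w ! e`. -/
inductive GuardComm (V : Type u) : Type u
  | input (w : V) (x : Var V)
  | output (w : V) (e : Store V → Val V)

/-- A guard: a Boolean expression, optionally followed by a communication statement. -/
structure Guard (V : Type u) : Type u where
  cond : Store V → Bool
  comm : Option (GuardComm V)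

/-- Sequential programs, given as a statement together with the rest of the program.
`select k g body rest` is the nondeterministic selection with alternatives `g i → body i`
(`i < k`), followed by `rest`, and `repeat_ k g body rest` is the nondeterministic repetition. -/
inductive Prog (V : Type u) : Type u
  | done
  | assign (x : Var V) (e : Store V → Val V) (rest : Prog V)
  | send (w : V) (e : Store V → Val V) (rest : Prog V)
  | recv (w : V) (x : Var V) (rest : Prog V)
  | select (k : ℕ) (g : Fin k → Guard V) (body : Fin k → Prog V) (rest : Prog V)
  | repeat_ (k : ℕ) (g : Fin k → Guard V) (body : Fin k → Prog V) (rest : Prog V)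

/-- Sequential composition. -/
def Prog.append {V : Type u} : Prog V → Prog V → Prog V
  | .done, q => q
  | .assign x e p, q => .assign x e (p.append q)
  | .send w e p, q => .send w e (p.append q)
  | .recv w x p, q => .recv w x (p.append q)
  | .select k g b p, q => .select k g b (p.append q)
  | .repeat_ k g b p, q => .repeat_ k g b (p.append q)

/-- The communication statement of a guard of process `v`, if any, is along an edge of `G`. -/
def Guard.Respects {V : Type u} (G : Digraph V) (v : V) (g : Guard V) : Prop :=
  (∀ w x, g.comm = some (.input w x) → G.Adj w v) ∧
  (∀ w e, g.comm = some (.output w e) → G.Adj v w)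

/-- All communication statements of a program of process `v` are along edges of `G`: outputs to `w`
need the edge `(v, w)` and inputs from `w` need the edge `(w, v)`. -/
def Prog.Respects {V : Type u} (G : Digraph V) (v : V) : Prog V → Prop
  | .done => True
  | .assign _ _ p => p.Respects G v
  | .send w _ p => G.Adj v w ∧ p.Respects G v
  | .recv w _ p => G.Adj w v ∧ p.Respects G v
  | .select _ g b p => (∀ i, (g i).Respects G v ∧ (b i).Respects G v) ∧ p.Respects G v
  | .repeat_ _ g b p => (∀ i, (g i).Respects G v ∧ (b i).Respects G v) ∧ p.Respects G v

/-- The guard contains no output statement. -/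
def Guard.NoOutput {V : Type u} (g : Guard V) : Prop :=
  ∀ w e, g.comm ≠ some (.output w e)

/-- The program belongs to the dialect `CSP_in`: no guard contains an output statement. -/
def Prog.InputGuardsOnly {V : Type u} : Prog V → Prop
  | .done => True
  | .assign _ _ p => p.InputGuardsOnly
  | .send _ _ p => p.InputGuardsOnly
  | .recv _ _ p => p.InputGuardsOnly
  | .select _ g b p => (∀ i, (g i).NoOutput ∧ (b i).InputGuardsOnly) ∧ p.InputGuardsOnly
  | .repeat_ _ g b p => (∀ i, (g i).NoOutput ∧ (b i).InputGuardsOnly) ∧ p.InputGuardsOnly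

/-! ### Actions of a single process -/

/-- A communication that a process is ready to perform at a guard. -/
inductive Offer (V : Type u) : Type u
  | input (w : V) (x : Var V)
  | output (w : V) (a : Val V)

/-- What a process does in one step.
* `assign x a`: assign the value `a` to `x`;
* `guards O`: evaluate the Boolean expressions of the guards of a selection or repetition, at
  least one of them being true; `O` describes the guards that are found true by the
  communications that they offer (`none` for a guard without communication statement);
* `exit`: find all guards of a repetition closed and leave it;
* `choose`: enter an alternative whose guard has no communication statement;
* `send w a`: send the value `a` to `w`;
* `recv w x a`: receive the value `a` from `w` into `x`. -/
inductive Action (V : Type u) : Type u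
  | assign (x : Var V) (a : Val V)
  | guards (O : Set (Option (Offer V)))
  | exit
  | choose
  | send (w : V) (a : Val V)
  | recv (w : V) (x : Var V) (a : Val V)

/-- The actions that involve one process only. -/
def Action.IsLocal {V : Type u} : Action V → Prop
  | .send _ _ => False
  | .recv _ _ _ => False
  | _ => True

/-! ### Renaming of process names -/

def Val.rename {V : Type u} (σ : V → V) : Val V → Val V
  | .bool b => .bool b
  | .int z => .int z
  | .name v => .name (σ v)
  | .pair a b => .pair (a.rename σ) (b.rename σ)

def Var.rename {V : Type u} (σ : V → V) : Var V → Var V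
  | .leader => .leader
  | .other n l => .other n (l.map σ)

def Offer.rename {V : Type u} (σ : V → V) : Offer V → Offer V
  | .input w x => .input (σ w) (x.rename σ)
  | .output w a => .output (σ w) (a.rename σ)

def Action.rename {V : Type u} (σ : V → V) : Action V → Action V
  | .assign x a => .assign (x.rename σ) (a.rename σ)
  | .guards O => .guards (Option.map (Offer.rename σ) '' O)
  | .exit => .exit
  | .choose => .choose
  | .send w a => .send (σ w) (a.rename σ)
  | .recv w x a => .recv (σ w) (x.rename σ) (a.rename σ)

/-! ### Operational semantics -/

/-- The execution position of a process: either it is about to run a program, or it has evaluated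
the Boolean guards of a selection or repetition and waits to enter an alternative; `next` is what
remains to be run after the body of that alternative. -/
inductive Position (V : Type u) : Type u
  | run (p : Prog V)
  | wait (k : ℕ) (g : Fin k → Guard V) (body : Fin k → Prog V) (next : Prog V)

/-- The state of one process. -/
structure LocalState (V : Type u) : Type u where
  pos : Position V
  store : Store V

/-- What a guard offers in a given store. -/
def Guard.offer {V : Type u} (g : Guard V) (s : Store V) : Option (Offer V) :=
  match g.comm with
  | none => none
  | some (.input w x) => some (.input w x)
  | some (.output w e) => some (.output w (e s))

/-- The offers of those guards whose Boolean expression is true. -/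
def offers {V : Type u} {k : ℕ} (g : Fin k → Guard V) (s : Store V) : Set (Option (Offer V)) :=
  {o | ∃ i, (g i).cond s = true ∧ (g i).offer s = o}

/-- The possible actions of a single process. An input can deliver any value; it is matched with an
output of the partner in `System.Step`. A selection all of whose guards are false fails: it has no
step. -/
inductive LocalStep {V : Type u} [DecidableEq V] :
    LocalState V → Action V → LocalState V → Prop
  | assign (x : Var V) (e : Store V → Val V) (p : Prog V) (s : Store V) :
      LocalStep ⟨.run (.assign x e p), s⟩ (.assign x (e s)) ⟨.run p, Function.update s x (e s)⟩
  | send (w : V) (e : Store V → Val V) (p : Prog V) (s : Store V) :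
      LocalStep ⟨.run (.send w e p), s⟩ (.send w (e s)) ⟨.run p, s⟩
  | recv (w : V) (x : Var V) (p : Prog V) (s : Store V) (a : Val V) :
      LocalStep ⟨.run (.recv w x p), s⟩ (.recv w x a) ⟨.run p, Function.update s x a⟩
  | select (k : ℕ) (g : Fin k → Guard V) (body : Fin k → Prog V) (p : Prog V) (s : Store V)
      (h : ∃ i, (g i).cond s = true) :
      LocalStep ⟨.run (.select k g body p), s⟩ (.guards (offers g s)) ⟨.wait k g body p, s⟩
  | repeat_ (k : ℕ) (g : Fin k → Guard V) (body : Fin k → Prog V) (p : Prog V) (s : Store V)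
      (h : ∃ i, (g i).cond s = true) :
      LocalStep ⟨.run (.repeat_ k g body p), s⟩ (.guards (offers g s))
        ⟨.wait k g body (.repeat_ k g body p), s⟩
  | exit (k : ℕ) (g : Fin k → Guard V) (body : Fin k → Prog V) (p : Prog V) (s : Store V)
      (h : ∀ i, (g i).cond s = false) :
      LocalStep ⟨.run (.repeat_ k g body p), s⟩ .exit ⟨.run p, s⟩
  | choose (k : ℕ) (g : Fin k → Guard V) (body : Fin k → Prog V) (p : Prog V) (s : Store V)
      (i : Fin k) (hc : (g i).cond s = true) (hi : (g i).comm = none) :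
      LocalStep ⟨.wait k g body p, s⟩ .choose ⟨.run ((body i).append p), s⟩
  | guardSend (k : ℕ) (g : Fin k → Guard V) (body : Fin k → Prog V) (p : Prog V) (s : Store V)
      (i : Fin k) (hc : (g i).cond s = true) (w : V) (e : Store V → Val V)
      (hi : (g i).comm = some (.output w e)) :
      LocalStep ⟨.wait k g body p, s⟩ (.send w (e s)) ⟨.run ((body i).append p), s⟩
  | guardRecv (k : ℕ) (g : Fin k → Guard V) (body : Fin k → Prog V) (p : Prog V) (s : Store V)
      (i : Fin k) (hc : (g i).cond s = true) (w : V) (x : Var V)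
      (hi : (g i).comm = some (.input w x)) (a : Val V) :
      LocalStep ⟨.wait k g body p, s⟩ (.recv w x a)
        ⟨.run ((body i).append p), Function.update s x a⟩

/-- A process system: one program for each process name. -/
structure System (V : Type u) : Type u where
  prog : V → Prog V

/-- `G` admits the system: all communication statements are along edges of `G`. -/
def System.AdmittedBy {V : Type u} (P : System V) (G : Digraph V) : Prop :=
  ∀ v, (P.prog v).Respects G v

/-- The system is a `CSP_in` system. -/
def System.InCSPin {V : Type u} (P : System V) : Prop :=
  ∀ v, (P.prog v).InputGuardsOnly

/-- A global state: the states of all processes. -/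
abbrev State (V : Type u) : Type u := V → LocalState V

def System.initState {V : Type u} (P : System V) : State V :=
  fun v => ⟨.run (P.prog v), Store.init⟩

/-- The computation steps: a local action of one process `v`, or a direct communication of the
value `a` from `v` to `w`, which receives it into its variable `x`. -/
inductive Event (V : Type u) : Type u
  | loc (v : V) (α : Action V)
  | comm (v w : V) (x : Var V) (a : Val V)

/-- The valid computation steps. -/
inductive Step {V : Type u} [DecidableEq V] : State V → Event V → State V → Prop
  | loc (s : State V) (v : V) (α : Action V) (t : LocalState V) (hα : α.IsLocal)
      (h : LocalStep (s v) α t) :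
      Step s (.loc v α) (Function.update s v t)
  | comm (s : State V) (v w : V) (x : Var V) (a : Val V) (t t' : LocalState V) (hvw : v ≠ w)
      (hs : LocalStep (s v) (.send w a) t) (hr : LocalStep (s w) (.recv v x a) t') :
      Step s (.comm v w x a) (Function.update (Function.update s v t) w t')

/-- A computation: a maximal (finite or infinite) sequence of valid computation steps from the
initial state. A finite computation is padded with `none`: the entry at time `n` is `none` exactly
when no step is possible in the state reached, and then the state stays the same forever. -/
structure Computation {V : Type u} [DecidableEq V] (P : System V) : Type u where
  state : ℕ → State V
  event : ℕ → Option (Event V)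
  init : state 0 = P.initState
  step : ∀ n e, event n = some e → Step (state n) e (state (n + 1))
  halt : ∀ n, event n = none →
    state (n + 1) = state n ∧ ∀ e s', ¬ Step (state n) e s'

/-- What process `u` does in a computation step, if it takes part in it. -/
def Event.actionOf {V : Type u} [DecidableEq V] (u : V) : Event V → Option (Action V)
  | .loc v α => if u = v then some α else none
  | .comm v w x a =>
      if u = v then some (.send w a) else if u = w then some (.recv v x a) else none

/-- The actions performed by process `v` during the first `n` steps, in order. -/
def Computation.history {V : Type u} [DecidableEq V] {P : System V} (C : Computation P)
    (v : V) (n : ℕ) : List (Action V) :=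
  (List.range n).filterMap fun i => (C.event i).bind (Event.actionOf v)

/-- The (finite or infinite) sequence of actions of process `w` in `C'` is the sequence of actions
of process `v` in `C` with all process names changed via `σ`: each finite piece of either is a
prefix of a finite piece of the other. -/
def SameStepsUpTo {V : Type u} [DecidableEq V] {P : System V} (σ : V → V)
    (C : Computation P) (v : V) (C' : Computation P) (w : V) : Prop :=
  (∀ n, ∃ m, (C.history v n).map (Action.rename σ) <+: C'.history w m) ∧
  (∀ m, ∃ n, C'.history w m <+: (C.history v n).map (Action.rename σ))

/-- The system with communication graph `G` is symmetric: for each automorphism `σ` of `G` and each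
computation `C` there is a computation in which each `P_{σ(v)}` performs the same steps as `P_v`
in `C`, with the process names changed via `σ`. -/
def System.Symmetric {V : Type u} [DecidableEq V] (P : System V) (G : Digraph V) : Prop :=
  ∀ σ : Equiv.Perm V, IsAutomorphism G σ → ∀ C : Computation P, ∃ C' : Computation P,
    ∀ v, SameStepsUpTo σ C v C' (σ v)

/-- `C` ends after `n` steps, with all processes having completed their programs. -/
def Computation.ProperlyTerminatedAt {V : Type u} [DecidableEq V] {P : System V}
    (C : Computation P) (n : ℕ) : Prop :=
  C.event n = none ∧ ∀ v, (C.state n v).pos = .run .done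

/-- An electoral system: all computations are properly terminating, and at termination the
variables `leader` of all processes contain the same process name. -/
def System.IsElectoral {V : Type u} [DecidableEq V] (P : System V) : Prop :=
  ∀ C : Computation P, ∃ n, C.ProperlyTerminatedAt n ∧
    ∃ w, ∀ v, (C.state n v).store .leader = .name w

/-- The system pairwise synchronizes the processes in `Q`: all computations are finite and properly
terminating and contain, for each pair of distinct processes in `Q`, a direct communication between
them. -/
def System.Synchronizes {V : Type u} [DecidableEq V] (P : System V) (Q : Set V) : Prop :=
  ∀ C : Computation P, (∃ n, C.ProperlyTerminatedAt n) ∧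
    ∀ a ∈ Q, ∀ b ∈ Q, a ≠ b →
      ∃ n x m, C.event n = some (.comm a b x m) ∨ C.event n = some (.comm b a x m)

end CSP

/-!
The system that synchronizes all pairs first runs the given electoral system `P`. The process `w`
that has been elected then chooses, nondeterministically, a walk `π` from a finite set `W`, and
sends a token along it; the token carries `π`, so that each process knows how to pass it on. Each
walk in `W` traverses an edge between any two vertices (`IsTourSet`). Such walks exist because `G`
is strongly and directly connected, and taking all of them up to some length makes `W` invariant
under automorphisms (`map_mem_tours`, `exists_isTourSet`). No canonical walk is needed for the
symmetry of the system: an automorphism maps the possible choices of `w` to those of its image.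

The difficulty is that the processes do not complete the election at the same time, so that the
token may reach a process `b` that is still running its election program. Values of the election
program and tokens are told apart by tags. The sender `a` of a token has completed the election,
whence `b` is not committed to an unguarded communication with `a`: otherwise `P` itself could
deadlock (`System.IsElectoral.not_committedTo`). Thus `b` receives the token at an input guard. In
the lifted program (`Prog.lift`) each input guard receives into a mailbox, and the value received is
inspected (`Prog.screen`): a tagged value is what the guard has been waiting for; a token is put
aside, and the selection or repetition is entered again. This does not disturb the election, and it
happens to each process at most once, because a process that has put the token aside passes it on
only after the election. Conversely an output of the election program never goes to a process that
has completed the election and is waiting for the token, again by `not_committedTo`. This is where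
the absence of output guards in `P` matters: an output guard may well address a completed process
without harm to `P`.

Each state of a process of the constructed system is summarized by a `Mode`, and each of its actions
is a transition `Trans` between modes, which either corresponds to one action of the process of `P`
or to none. `Invariant` relates a run of the constructed system to a run of `P` and to the position
of the token; it is preserved by all steps (`Invariant.step`).

* Termination: with each step either `P` makes a step, or the number of the remaining moves of the
  token decreases, or else the sum of the ranks of the modes does (`Progress`); the steps of `P`
  from a reachable state form a well-founded relation (`System.IsElectoral.acc`).
* No deadlock: where no step is possible, `P` cannot make a step either, so that the election is
  complete, and then the token can move unless its walk has come to the end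
  (`Invariant.of_not_step`).
* Symmetry: `Trans` does not mention programs and is preserved by automorphisms (`Trans.rename`).
  The local traces of a completed computation project to local traces of a completed computation of
  `P`. By the symmetry of `P` these can be renamed, each by itself, and `Translation.exists_localRun`
  lifts the renamed traces to the constructed system. A sequence of events whose restriction to each
  process is a local trace is a run (`run_of_localRuns`), which is the computation required.
-/

/-! ### Finite runs and their local traces -/

namespace CSP

variable {V : Type u} [DecidableEq V]

/-- A finite sequence of computation steps leading from one global state to another. -/
inductive Run : State V → List (Event V) → State V → Prop
  | nil (s : State V) : Run s [] s
  | cons {s s₁ s₂ : State V} {e : Event V} {E : List (Event V)} :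
      Step s e s₁ → Run s₁ E s₂ → Run s (e :: E) s₂

/-- A finite sequence of actions of a single process. Inputs may deliver arbitrary values. -/
inductive LocalRun : LocalState V → List (Action V) → LocalState V → Prop
  | nil (q : LocalState V) : LocalRun q [] q
  | cons {q q₁ q₂ : LocalState V} {α : Action V} {h : List (Action V)} :
      LocalStep q α q₁ → LocalRun q₁ h q₂ → LocalRun q (α :: h) q₂

theorem Run.append {s s₁ s₂ : State V} {E F : List (Event V)} (h : Run s E s₁)
    (h' : Run s₁ F s₂) : Run s (E ++ F) s₂ := by
  induction h with
  | nil => exact h'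
  | cons hs _ ih => exact .cons hs (ih h')

theorem Run.snoc {s s₁ s₂ : State V} {E : List (Event V)} {e : Event V} (h : Run s E s₁)
    (h' : Step s₁ e s₂) : Run s (E ++ [e]) s₂ :=
  h.append (.cons h' (.nil _))

theorem LocalRun.append {q q₁ q₂ : LocalState V} {h h' : List (Action V)} (r : LocalRun q h q₁)
    (r' : LocalRun q₁ h' q₂) : LocalRun q (h ++ h') q₂ := by
  induction r with
  | nil => exact r'
  | cons hs _ ih => exact .cons hs (ih r')

theorem LocalRun.snoc {q q₁ q₂ : LocalState V} {h : List (Action V)} {α : Action V}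
    (r : LocalRun q h q₁) (s : LocalStep q₁ α q₂) : LocalRun q (h ++ [α]) q₂ :=
  r.append (.cons s (.nil _))

theorem LocalRun.of_append {q q₂ : LocalState V} {h h' : List (Action V)}
    (r : LocalRun q (h ++ h') q₂) : ∃ q₁, LocalRun q h q₁ ∧ LocalRun q₁ h' q₂ := by
  induction h generalizing q with
  | nil => exact ⟨q, .nil _, r⟩
  | cons α h ih =>
    cases r with
    | cons hs r =>
      obtain ⟨q₁, h₁, h₂⟩ := ih r
      exact ⟨q₁, .cons hs h₁, h₂⟩

theorem LocalRun.of_snoc {q q₂ : LocalState V} {h : List (Action V)} {α : Action V}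
    (r : LocalRun q (h ++ [α]) q₂) : ∃ q₁, LocalRun q h q₁ ∧ LocalStep q₁ α q₂ := by
  obtain ⟨q₁, h₁, h₂⟩ := r.of_append
  cases h₂ with
  | cons hs hr =>
    cases hr
    exact ⟨q₁, h₁, hs⟩

/-- The actions of process `v` in a sequence of events. -/
def hist (v : V) (E : List (Event V)) : List (Action V) :=
  E.filterMap (Event.actionOf v)

@[simp] theorem hist_nil (v : V) : hist v [] = [] := rfl

theorem hist_append (v : V) (E F : List (Event V)) : hist v (E ++ F) = hist v E ++ hist v F :=
  List.filterMap_append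

theorem hist_loc_self (v : V) (α : Action V) : hist v [.loc v α] = [α] := by
  simp [hist, Event.actionOf]

theorem hist_loc_of_ne {u v : V} (h : u ≠ v) (α : Action V) : hist u [.loc v α] = [] := by
  simp [hist, Event.actionOf, h]

theorem hist_comm_left (v w : V) (x : Var V) (a : Val V) :
    hist v [.comm v w x a] = [.send w a] := by
  simp [hist, Event.actionOf]

theorem hist_comm_right {v w : V} (h : v ≠ w) (x : Var V) (a : Val V) :
    hist w [.comm v w x a] = [.recv v x a] := by
  simp [hist, Event.actionOf, h.symm]

theorem hist_comm_of_ne {u v w : V} (h : u ≠ v) (h' : u ≠ w) (x : Var V) (a : Val V) :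
    hist u [.comm v w x a] = [] := by
  simp [hist, Event.actionOf, h, h']

theorem Step.localRun {s t : State V} {e : Event V} (h : Step s e t) (u : V) :
    LocalRun (s u) (hist u [e]) (t u) := by
  cases h with
  | loc v α t hα h =>
    by_cases huv : u = v
    · subst huv
      rw [hist_loc_self, Function.update_self]
      exact .cons h (.nil _)
    · rw [hist_loc_of_ne huv, Function.update_of_ne huv]
      exact .nil _
  | comm v w x a t t' hvw hs hr =>
    by_cases huw : u = w
    · subst huw
      rw [hist_comm_right hvw, Function.update_self]
      exact .cons hr (.nil _)
    · rw [Function.update_of_ne huw]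
      by_cases huv : u = v
      · subst huv
        rw [hist_comm_left, Function.update_self]
        exact .cons hs (.nil _)
      · rw [hist_comm_of_ne huv huw, Function.update_of_ne huv]
        exact .nil _

theorem Run.localRun {s t : State V} {E : List (Event V)} (h : Run s E t) (u : V) :
    LocalRun (s u) (hist u E) (t u) := by
  induction h with
  | nil => exact .nil _
  | @cons _ _ _ e E hs _ ih =>
    rw [show e :: E = [e] ++ E from rfl, hist_append]
    exact (hs.localRun u).append ih

/-- A local event carries a local action, and nobody communicates with himself. -/
def Event.WellFormed : Event V → Prop
  | .loc _ α => α.IsLocal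
  | .comm v w _ _ => v ≠ w

theorem Run.wellFormed {s t : State V} {E : List (Event V)} (h : Run s E t) :
    ∀ e ∈ E, e.WellFormed := by
  induction h with
  | nil => simp
  | cons hs _ ih =>
    intro e' he'
    rcases List.mem_cons.1 he' with rfl | he'
    · cases hs with
      | loc v α t hα h => exact hα
      | comm v w x a t t' hvw hs hr => exact hvw
    · exact ih e' he'

/-- A sequence of events can be performed as soon as each process can perform its own part of it. -/
theorem run_of_localRuns {s t : State V} {E : List (Event V)} (hE : ∀ e ∈ E, e.WellFormed)
    (h : ∀ v, LocalRun (s v) (hist v E) (t v)) : Run s E t := by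
  induction E generalizing s with
  | nil =>
    have : s = t := funext fun v => by
      have := h v
      rw [hist_nil] at this
      generalize s v = a at this
      generalize t v = b at this
      cases this
      rfl
    exact this ▸ .nil _
  | cons e E ih =>
    have hE' : ∀ e ∈ E, e.WellFormed := fun e he => hE e (List.mem_cons_of_mem _ he)
    have he : e.WellFormed := hE e List.mem_cons_self
    have h' : ∀ v, ∃ q, LocalRun (s v) (hist v [e]) q ∧ LocalRun q (hist v E) (t v) := fun v => by
      have := h v
      rw [show e :: E = [e] ++ E from rfl, hist_append] at this
      exact this.of_append
    choose q hq hq' using h'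
    refine .cons ?_ (ih hE' hq')
    have hnil : ∀ v, hist v [e] = [] → q v = s v := fun v hv => by
      have := hq v
      rw [hv] at this
      generalize s v = a at this
      generalize q v = b at this
      cases this
      rfl
    have hone : ∀ v α, hist v [e] = [α] → LocalStep (s v) α (q v) := fun v α hv => by
      have := hq v
      rw [hv] at this
      generalize s v = a at this
      generalize q v = b at this
      cases this with
      | cons h1 h2 =>
        cases h2
        exact h1
    cases e with
    | loc v α =>
      have := Step.loc s v α (q v) he (hone v α (hist_loc_self v α))
      convert this using 1
      funext u
      by_cases huv : u = v
      · subst huv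
        rw [Function.update_self]
      · rw [Function.update_of_ne huv]
        exact hnil u (hist_loc_of_ne huv α)
    | comm v w x a =>
      have := Step.comm s v w x a (q v) (q w) he (hone v _ (hist_comm_left v w x a))
        (hone w _ (hist_comm_right he x a))
      convert this using 1
      funext u
      by_cases huw : u = w
      · subst huw
        rw [Function.update_self]
      · rw [Function.update_of_ne huw]
        by_cases huv : u = v
        · subst huv
          rw [Function.update_self]
        · rw [Function.update_of_ne huv]
          exact hnil u (hist_comm_of_ne huv huw x a)

/-! ### Computations and finite runs -/

/-- A maximal sequence of steps from an arbitrary state. -/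
structure MaximalRun (s : State V) where
  state : ℕ → State V
  event : ℕ → Option (Event V)
  init : state 0 = s
  step : ∀ n e, event n = some e → Step (state n) e (state (n + 1))
  halt : ∀ n, event n = none → state (n + 1) = state n ∧ ∀ e s', ¬ Step (state n) e s'

/-- A finite run followed by a maximal sequence of steps is a maximal sequence of steps. -/
theorem MaximalRun.exists_prepend {s t : State V} {E : List (Event V)} (h : Run s E t)
    (M : MaximalRun t) : ∃ M' : MaximalRun s, (∀ n < E.length, M'.event n = E[n]?) ∧
      ∀ n, M'.state (E.length + n) = M.state n ∧ M'.event (E.length + n) = M.event n := by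
  induction h with
  | nil => exact ⟨M, by simp, by simp⟩
  | @cons s s₁ s₂ e E hs _ ih =>
    obtain ⟨M', h1, h2⟩ := ih M
    refine ⟨⟨fun n => Nat.casesOn n s M'.state, fun n => Nat.casesOn n (some e) M'.event, rfl,
      ?_, ?_⟩, ?_, ?_⟩
    · rintro (_ | n) e' he'
      · obtain rfl : e = e' := Option.some.inj he'
        change Step s e (M'.state 0)
        rwa [M'.init]
      · exact M'.step n e' he'
    · rintro (_ | n) he'
      · simp at he'
      · exact M'.halt n he'
    · rintro (_ | n) hn
      · simp
      · simpa using h1 n (by simpa using hn)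
    · intro n
      have : (e :: E).length + n = (E.length + n) + 1 := by simp; omega
      rw [this]
      exact h2 n

/-- The events of the first `n` entries of a computation. -/
def Computation.events {P : System V} (C : Computation P) (n : ℕ) : List (Event V) :=
  (List.range n).filterMap C.event

theorem Computation.events_succ {P : System V} (C : Computation P) (n : ℕ) :
    C.events (n + 1) = C.events n ++ (C.event n).toList := by
  simp only [events, List.range_succ, List.filterMap_append]
  cases h : C.event n <;> simp [h]

theorem Computation.history_eq {P : System V} (C : Computation P) (v : V) (n : ℕ) :
    C.history v n = hist v (C.events n) := by
  simp only [history, hist, events, List.filterMap_filterMap]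

theorem Computation.run {P : System V} (C : Computation P) (n : ℕ) :
    Run P.initState (C.events n) (C.state n) := by
  induction n with
  | zero => exact C.init ▸ .nil _
  | succ n ih =>
    rw [C.events_succ]
    cases h : C.event n with
    | none =>
      rw [(C.halt n h).1]
      simpa using ih
    | some e => exact ih.snoc (C.step n e h)

theorem Computation.halted {P : System V} (C : Computation P) {n m : ℕ} (h : C.event n = none)
    (hnm : n ≤ m) : C.event m = none ∧ C.state m = C.state n ∧ C.events m = C.events n := by
  induction m, hnm using Nat.le_induction with
  | base => exact ⟨h, rfl, rfl⟩
  | succ m _ ih =>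
    obtain ⟨h1, h2, h3⟩ := ih
    have h4 := (C.halt m h1).1
    refine ⟨?_, h4.trans h2, ?_⟩
    · cases h5 : C.event (m + 1) with
      | none => rfl
      | some e =>
        have := C.step _ _ h5
        rw [h4] at this
        exact ((C.halt m h1).2 _ _ this).elim
    · rw [C.events_succ, h1, h3]
      simp

theorem Computation.events_prefix {P : System V} (C : Computation P) {n m : ℕ} (h : n ≤ m) :
    C.events n <+: C.events m := by
  induction m, h using Nat.le_induction with
  | base => exact List.prefix_refl _
  | succ m _ ih => exact ih.trans (C.events_succ m ▸ List.prefix_append _ _)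

theorem Computation.exists_of_run {P : System V} {E : List (Event V)} {s : State V}
    (h : Run P.initState E s) (M : MaximalRun s) : ∃ C : Computation P,
      C.events E.length = E ∧
      ∀ n, C.state (E.length + n) = M.state n ∧ C.event (E.length + n) = M.event n := by
  obtain ⟨M', h1, h2⟩ := M.exists_prepend h
  let C : Computation P := ⟨M'.state, M'.event, M'.init, M'.step, M'.halt⟩
  refine ⟨C, ?_, h2⟩
  have : ∀ n ≤ E.length, C.events n = E.take n := fun n => by
    induction n with
    | zero => simp [events]
    | succ n ih =>
      intro hn
      rw [C.events_succ, ih (by omega), List.take_add_one]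
      congr 2
      exact h1 n hn
  simpa using this _ le_rfl

/-- A run to a state in which no step is possible is a computation. -/
theorem Computation.exists_of_run_halted {P : System V} {E : List (Event V)} {s : State V}
    (h : Run P.initState E s) (hs : ∀ e t, ¬ Step s e t) : ∃ C : Computation P,
      C.events E.length = E ∧ C.event E.length = none ∧ C.state E.length = s := by
  obtain ⟨C, h1, h2⟩ := exists_of_run h
    ⟨fun _ => s, fun _ => none, rfl, by simp, fun _ _ => ⟨rfl, hs⟩⟩
  exact ⟨C, h1, (h2 0).2, (h2 0).1⟩

/-! ### Processes that have completed their programs -/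

/-- The process has completed its program. -/
def LocalState.Done (q : LocalState V) : Prop := q.pos = .run .done

theorem LocalState.Done.not_localStep {q q' : LocalState V} {α : Action V} (h : q.Done) :
    ¬ LocalStep q α q' := by
  intro hs
  cases hs <;> simp [LocalState.Done] at h

theorem not_step_of_done {s t : State V} {e : Event V} (h : ∀ v, (s v).Done) : ¬ Step s e t := by
  intro hs
  cases hs with
  | loc v α t hα hl => exact (h v).not_localStep hl
  | comm v w x a t t' hvw hl hr => exact (h v).not_localStep hl

theorem Step.eq_of_done {s t : State V} {e : Event V} (h : Step s e t) {v : V}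
    (hv : (s v).Done) : t v = s v := by
  have := h.localRun v
  generalize s v = a at *
  generalize t v = b at *
  generalize hist v [e] = l at *
  cases this with
  | nil => rfl
  | cons hs _ => exact (hv.not_localStep hs).elim

theorem Run.eq_of_done {s t : State V} {E : List (Event V)} (h : Run s E t) {v : V}
    (hv : (s v).Done) : t v = s v := by
  induction h with
  | nil => rfl
  | cons hs _ ih =>
    have := hs.eq_of_done hv
    rw [ih (this ▸ hv), this]

/-- The process is committed to a communication with `b`: its next command is an output to `b` or
an input from `b` that is not part of a guard. -/
def LocalState.CommittedTo (b : V) (q : LocalState V) : Prop :=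
  (∃ e p, q.pos = .run (.send b e p)) ∨ ∃ x p, q.pos = .run (.recv b x p)

/-- A process that is committed to a communication with a completed process is stuck. -/
theorem Step.eq_of_committedTo {s t : State V} {e : Event V} (h : Step s e t) {a b : V}
    (ha : (s a).CommittedTo b) (hb : (s b).Done) : t a = s a := by
  have key : ∀ α q, LocalStep (s a) α q →
      (∃ c, α = .send b c) ∨ ∃ x c, α = .recv b x c := by
    intro α q hq
    generalize s a = r at *
    rcases ha with ⟨e, p, hp⟩ | ⟨e, p, hp⟩ <;> cases hq <;> simp at hp
    · exact .inl ⟨_, by rw [hp.1]⟩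
    · exact .inr ⟨_, _, by rw [hp.1]⟩
  cases h with
  | loc v α t hα hl =>
    by_cases hav : a = v
    · subst hav
      rcases key _ _ hl with ⟨c, rfl⟩ | ⟨x, c, rfl⟩ <;> exact hα.elim
    · rw [Function.update_of_ne hav]
  | comm v w x c t t' hvw hl hr =>
    by_cases hav : a = v
    · subst hav
      rcases key _ _ hl with ⟨c, hc⟩ | ⟨x, c, hc⟩ <;> cases hc
      exact (hb.not_localStep hr).elim
    · by_cases haw : a = w
      · subst haw
        rcases key _ _ hr with ⟨c, hc⟩ | ⟨x, c, hc⟩ <;> cases hc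
        exact (hb.not_localStep hl).elim
      · rw [Function.update_of_ne haw, Function.update_of_ne hav]

theorem Run.eq_of_committedTo {s t : State V} {E : List (Event V)} (h : Run s E t) {a b : V}
    (ha : (s a).CommittedTo b) (hb : (s b).Done) : t a = s a := by
  induction h with
  | nil => rfl
  | cons hs _ ih =>
    have h1 := hs.eq_of_committedTo ha hb
    rw [ih (h1 ▸ ha) (hs.eq_of_done hb ▸ hb), h1]

/-! ### Reachable states of an electoral system -/

theorem System.IsElectoral.of_not_step {P : System V} (hP : P.IsElectoral) {E : List (Event V)}
    {s : State V} (h : Run P.initState E s) (hs : ∀ e t, ¬ Step s e t) :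
    (∀ v, (s v).Done) ∧ ∃ w, ∀ v, (s v).store .leader = .name w := by
  obtain ⟨C, -, h2, h3⟩ := Computation.exists_of_run_halted h hs
  obtain ⟨n, ⟨hn, hd⟩, hw⟩ := hP C
  have : C.state n = s := by
    rcases le_total n E.length with hle | hle
    · exact (C.halted hn hle).2.1.symm.trans h3
    · exact (C.halted h2 hle).2.1.trans h3
  subst this
  exact ⟨hd, hw⟩

/-- The system cannot make infinitely many steps from a reachable state. -/
theorem System.IsElectoral.acc {P : System V} (hP : P.IsElectoral) {E : List (Event V)}
    {s : State V} (h : Run P.initState E s) : Acc (fun t s => ∃ e, Step s e t) s := by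
  by_contra hacc
  obtain ⟨f, hf0, hf⟩ := not_acc_iff_exists_descending_chain.1 hacc
  choose ev hev using hf
  obtain ⟨C, -, h2⟩ := Computation.exists_of_run h
    ⟨f, fun n => some (ev n), hf0, fun n e he => by cases he; exact hev n, by simp⟩
  obtain ⟨n, ⟨hn, -⟩, -⟩ := hP C
  have := (C.halted hn (Nat.le_add_left n E.length)).1
  rw [(h2 n).2] at this
  cases this

/-- Each run of an electoral system can be continued to proper termination. -/
theorem System.IsElectoral.exists_final {P : System V} (hP : P.IsElectoral) {E : List (Event V)}
    {s : State V} (h : Run P.initState E s) : ∃ F t, Run s F t ∧ (∀ v, (t v).Done) ∧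
      ∃ w, ∀ v, (t v).store .leader = .name w := by
  have hacc := hP.acc h
  induction hacc generalizing E with
  | intro s _ ih =>
    by_cases hs : ∃ e t, Step s e t
    · obtain ⟨e, t, hst⟩ := hs
      obtain ⟨F, t', h1, h2⟩ := ih t ⟨e, hst⟩ (h.snoc hst)
      exact ⟨e :: F, t', .cons hst h1, h2⟩
    · push Not at hs
      exact ⟨[], s, .nil _, hP.of_not_step h hs⟩

/-- In a reachable state the processes that have completed their programs agree on the leader. -/
theorem System.IsElectoral.leader_of_done {P : System V} (hP : P.IsElectoral)
    {E : List (Event V)} {s : State V} (h : Run P.initState E s) :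
    ∃ w, ∀ v, (s v).Done → (s v).store .leader = .name w := by
  obtain ⟨F, t, h1, h2, w, hw⟩ := hP.exists_final h
  exact ⟨w, fun v hv => h1.eq_of_done hv ▸ hw v⟩

theorem System.IsElectoral.leader_unique {P : System V} (hP : P.IsElectoral)
    {E : List (Event V)} {s : State V} (h : Run P.initState E s) {u v x y : V}
    (hu : (s u).Done) (hv : (s v).Done) (hx : (s u).store .leader = .name x)
    (hy : (s v).store .leader = .name y) : x = y := by
  obtain ⟨w, hw⟩ := hP.leader_of_done h
  have h1 := (hw u hu).symm.trans hx
  have h2 := (hw v hv).symm.trans hy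
  cases h1
  cases h2
  rfl

/-- In a reachable state no process is committed to a communication with a process that has
completed its program: it would wait forever. -/
theorem System.IsElectoral.not_committedTo {P : System V} (hP : P.IsElectoral)
    {E : List (Event V)} {s : State V} (h : Run P.initState E s) {a b : V} (hb : (s b).Done) :
    ¬ (s a).CommittedTo b := by
  intro ha
  obtain ⟨F, t, h1, h2, -⟩ := hP.exists_final h
  have h3 := h2 a
  rw [h1.eq_of_committedTo ha hb] at h3
  rcases ha with ⟨e, p, hp⟩ | ⟨e, p, hp⟩ <;> simp [LocalState.Done, hp] at h3

/-! ### Symmetry in terms of finite runs -/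

/-- In an electoral symmetric system the renamed local traces of a completed run are again local
traces leading to completion. -/
theorem System.Symmetric.exists_localRun {P : System V} {G : Digraph V} (hS : P.Symmetric G)
    (hP : P.IsElectoral) {σ : Equiv.Perm V} (hσ : IsAutomorphism G σ) {E : List (Event V)}
    {s : State V} (h : Run P.initState E s) (hs : ∀ v, (s v).Done) (v : V) :
    ∃ q : LocalState V, q.Done ∧
      LocalRun (P.initState (σ v)) ((hist v E).map (Action.rename σ)) q := by
  obtain ⟨C, h1, h2, h3⟩ := Computation.exists_of_run_halted h fun _ _ => not_step_of_done hs
  obtain ⟨C', hC'⟩ := hS σ hσ C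
  obtain ⟨n, ⟨hn, hd⟩, -⟩ := hP C'
  refine ⟨C'.state n (σ v), hd _, ?_⟩
  have key : (hist v E).map (Action.rename σ) = C'.history (σ v) n := by
    obtain ⟨ha, hb⟩ := hC' v
    simp only [Computation.history_eq] at *
    have hmax : ∀ m, C.events m <+: E := fun m => by
      have := C.events_prefix (Nat.le_max_left m E.length)
      rwa [(C.halted h2 (Nat.le_max_right m E.length)).2.2, h1] at this
    have hmax' : ∀ m, C'.events m <+: C'.events n := fun m => by
      have := C'.events_prefix (Nat.le_max_left m n)
      rwa [(C'.halted hn (Nat.le_max_right m n)).2.2] at this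
    obtain ⟨m, hm⟩ := ha E.length
    obtain ⟨m', hm'⟩ := hb n
    rw [h1] at hm
    refine List.Sublist.antisymm ?_ ?_
    · exact (hm.trans ((hmax' m).filterMap _)).sublist
    · exact (hm'.trans (((hmax m').filterMap _).map _)).sublist
  rw [key, Computation.history_eq]
  exact (C'.run n).localRun (σ v)

/-- The event with all process names changed via `σ`. -/
def Event.rename (σ : V → V) : Event V → Event V
  | .loc v α => .loc (σ v) (α.rename σ)
  | .comm v w x a => .comm (σ v) (σ w) (x.rename σ) (a.rename σ)

theorem hist_map_rename (σ : Equiv.Perm V) (v : V) (E : List (Event V)) :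
    hist (σ v) (E.map (Event.rename σ)) = (hist v E).map (Action.rename σ) := by
  simp only [hist, List.filterMap_map, List.map_filterMap]
  congr 1
  funext e
  cases e with
  | loc u α =>
    by_cases h : v = u <;> simp [Event.rename, Event.actionOf, h]
  | comm u w x a =>
    by_cases h : v = u
    · simp [Event.rename, Event.actionOf, h, Action.rename]
    · by_cases h' : v = w
      · simp [Event.rename, Event.actionOf, h', Action.rename, h' ▸ h]
      · simp [Event.rename, Event.actionOf, h, h']

theorem Event.WellFormed.rename {V : Type u} {e : Event V} (h : e.WellFormed) (σ : Equiv.Perm V) :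
    (e.rename σ).WellFormed := by
  cases e with
  | loc v α => cases α <;> simp_all [WellFormed, Event.rename, Action.rename, Action.IsLocal]
  | comm v w x a => simpa [WellFormed, Event.rename] using h

/-- A system all of whose computations terminate properly is symmetric as soon as the renamed local
traces of each completed run are again local traces leading to completion. -/
theorem System.symmetric_of_localRun {Q : System V} {G : Digraph V}
    (hQ : ∀ C : Computation Q, ∃ n, C.ProperlyTerminatedAt n)
    (h : ∀ σ : Equiv.Perm V, IsAutomorphism G σ → ∀ (E : List (Event V)) (s : State V),
      Run Q.initState E s → (∀ v, (s v).Done) → ∀ v, ∃ q : LocalState V, q.Done ∧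
        LocalRun (Q.initState (σ v)) ((hist v E).map (Action.rename σ)) q) :
    Q.Symmetric G := by
  intro σ hσ C
  obtain ⟨n, hn, hd⟩ := hQ C
  choose q hq hq' using h σ hσ _ _ (C.run n) hd
  have hrun : Run Q.initState ((C.events n).map (Event.rename σ)) (fun v => q (σ.symm v)) := by
    refine run_of_localRuns ?_ fun v => ?_
    · intro e he
      obtain ⟨e', he', rfl⟩ := List.mem_map.1 he
      exact ((C.run n).wellFormed e' he').rename σ
    · obtain ⟨u, rfl⟩ := σ.surjective v
      rw [hist_map_rename]
      simpa using hq' u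
  obtain ⟨C', h1, h2, -⟩ := Computation.exists_of_run_halted hrun
    fun _ _ => not_step_of_done fun v => hq _
  refine ⟨C', fun v => ⟨fun m => ⟨((C.events n).map (Event.rename σ)).length, ?_⟩,
    fun m => ⟨n, ?_⟩⟩⟩
  · rw [C'.history_eq, h1, C.history_eq, hist_map_rename]
    have := C.events_prefix (Nat.le_max_left m n)
    rw [(C.halted hn (Nat.le_max_right _ _)).2.2] at this
    exact (this.filterMap _).map _
  · rw [C'.history_eq, C.history_eq, ← hist_map_rename, ← h1]
    have := C'.events_prefix (Nat.le_max_left m ((C.events n).map (Event.rename σ)).length)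
    rw [(C'.halted h2 (Nat.le_max_right _ _)).2.2] at this
    exact this.filterMap _

end CSP

/-! ### Tagged values and shifted variables -/

namespace CSP

section Lift

variable {V : Type u}

/-- The mailbox into which the input guards of the lifted programs receive. -/
def tmpVar : Var V := .other 0 []

/-- The variable that holds the token. -/
def planVar : Var V := .other 1 []

/-- The variable of a lifted program that corresponds to a variable of the given program. Its values
avoid `tmpVar` and `planVar`. -/
def Var.shift : Var V → Var V
  | .leader => .leader
  | .other n l => .other (n + 2) l

/-- The tag of the values that the given programs compute and exchange. -/
def Val.enc (a : Val V) : Val V := .pair (.bool true) a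

/-- Removes the tag. Untagged values are left as they are, so that the initial value stands for
itself. -/
def Val.dec : Val V → Val V
  | .pair (.bool true) a => a
  | a => a

/-- A list of names as a value. -/
def Val.ofList : List V → Val V
  | [] => .int 0
  | v :: l => .pair (.name v) (ofList l)

/-- The token, which carries the list of the names that it is going to visit. -/
def Val.token (π : List V) : Val V := .pair (.bool false) (.ofList π)

/-- Whether a value has the tag of tokens. -/
def Val.isToken : Val V → Bool
  | .pair (.bool false) _ => true
  | _ => false

/-- The store of the given program that is represented by a store of the lifted program. -/
def Store.decode (s : Store V) : Store V := fun x => (s x.shift).dec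

@[simp] theorem Val.dec_enc (a : Val V) : a.enc.dec = a := rfl
@[simp] theorem Val.isToken_enc (a : Val V) : a.enc.isToken = false := rfl
@[simp] theorem Val.isToken_token (π : List V) : (Val.token π).isToken = true := rfl

theorem Val.ofList_injective : Function.Injective (Val.ofList (V := V)) := fun l l' h => by
  induction l generalizing l' with
  | nil => cases l' <;> simp_all [Val.ofList]
  | cons v l ih =>
    cases l' with
    | nil => simp [Val.ofList] at h
    | cons v' l' =>
      simp only [Val.ofList, Val.pair.injEq, Val.name.injEq] at h
      rw [h.1, @ih l' h.2]

theorem Val.token_injective : Function.Injective (Val.token (V := V)) := fun l l' h =>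
  Val.ofList_injective (by simpa [Val.token] using h)

theorem Var.shift_injective : Function.Injective (Var.shift (V := V)) := fun x y h => by
  cases x <;> cases y <;> simp_all [Var.shift]

@[simp] theorem Var.shift_ne_tmpVar (x : Var V) : x.shift ≠ tmpVar := by
  cases x <;> simp [Var.shift, tmpVar]

@[simp] theorem Var.shift_ne_planVar (x : Var V) : x.shift ≠ planVar := by
  cases x <;> simp [Var.shift, planVar]

@[simp] theorem planVar_ne_tmpVar : (planVar : Var V) ≠ tmpVar := by simp [planVar, tmpVar]

section Update

variable [DecidableEq V]

@[simp] theorem Store.decode_update_shift (s : Store V) (x : Var V) (a : Val V) :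
    Store.decode (Function.update s x.shift a.enc) = Function.update s.decode x a := by
  funext y
  by_cases h : y = x
  · subst h
    simp [Store.decode]
  · simp [Store.decode, h, Var.shift_injective.ne h]

@[simp] theorem Store.decode_update_tmpVar (s : Store V) (a : Val V) :
    Store.decode (Function.update s tmpVar a) = s.decode := by
  funext y
  simp [Store.decode]

@[simp] theorem Store.decode_update_planVar (s : Store V) (a : Val V) :
    Store.decode (Function.update s planVar a) = s.decode := by
  funext y
  simp [Store.decode]

end Update

/-! ### Lifted programs -/

/-- The lifted guard: Boolean expressions look at the decoded store, inputs go to the mailbox. -/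
def Guard.lift (g : Guard V) : Guard V where
  cond s := g.cond s.decode
  comm := match g.comm with
    | none => none
    | some (.input w _) => some (.input w tmpVar)
    | some (.output w e) => some (.output w fun s => (e s.decode).enc)

/-- The offer of the lifted guard: the mailbox replaces the variable of an input, and the value of
an output is tagged. -/
def Offer.lift : Offer V → Offer V
  | .input w _ => .input w tmpVar
  | .output w a => .output w a.enc

/-- Looks at a value that has just been received into the mailbox: a token is moved to `planVar`,
whereupon `Z` is run; any other value is moved to `x`, whereupon `q` is run. -/
def Prog.screen (Z : Prog V) (x : Var V) (q : Prog V) : Prog V :=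
  .select 2
    (fun i => ⟨fun s => if i = 0 then !(s tmpVar).isToken else (s tmpVar).isToken, none⟩)
    (fun i => if i = 0 then .assign x.shift (fun s => s tmpVar) q
      else .assign planVar (fun s => s tmpVar) Z)
    .done

/-- The lifted form of an alternative with guard `g`, where `q` is the lifted body, and `Z` is what
to do if the guard has received a token. -/
def Guard.liftBody (g : Guard V) (Z q : Prog V) : Prog V :=
  match g.comm with
  | some (.input _ x) => .screen Z x q
  | _ => q

/-- The given program on tagged values and shifted variables, except that an input guard may also
receive a token. In that case the token is stored, and the selection or repetition is entered once
more. A second token is not provided for: there will be only one in the network. -/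
def Prog.lift : Prog V → Prog V
  | .done => .done
  | .assign x e p => .assign x.shift (fun s => (e s.decode).enc) p.lift
  | .send w e p => .send w (fun s => (e s.decode).enc) p.lift
  | .recv w x p => .recv w x.shift p.lift
  | .select k g b p => .select k (fun i => (g i).lift)
      (fun i => (g i).liftBody
        (.select k (fun j => (g j).lift) (fun j => (g j).liftBody .done (b j).lift) .done)
        (b i).lift)
      p.lift
  | .repeat_ k g b p => .repeat_ k (fun i => (g i).lift)
      (fun i => (g i).liftBody .done (b i).lift) p.lift

theorem Prog.lift_append (p q : Prog V) : (p.append q).lift = p.lift.append q.lift := by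
  induction p with
  | done => rfl
  | assign x e p ih => simp only [append, lift, ih]
  | send w e p ih => simp only [append, lift, ih]
  | recv w x p ih => simp only [append, lift, ih]
  | select k g b p _ ih => simp only [append, lift, ih]
  | repeat_ k g b p _ ih => simp only [append, lift, ih]

theorem Prog.append_assoc (p q r : Prog V) : (p.append q).append r = p.append (q.append r) := by
  induction p with
  | done => rfl
  | assign x e p ih => simp only [append, ih]
  | send w e p ih => simp only [append, ih]
  | recv w x p ih => simp only [append, ih]
  | select k g b p _ ih => simp only [append, ih]
  | repeat_ k g b p _ ih => simp only [append, ih]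

theorem Prog.InputGuardsOnly.append {p q : Prog V} (hp : p.InputGuardsOnly)
    (hq : q.InputGuardsOnly) : (p.append q).InputGuardsOnly := by
  induction p with
  | done => exact hq
  | assign x e p ih => exact ih hp
  | send w e p ih => exact ih hp
  | recv w x p ih => exact ih hp
  | select k g b p _ ih => exact ⟨hp.1, ih hp.2⟩
  | repeat_ k g b p _ ih => exact ⟨hp.1, ih hp.2⟩

theorem Prog.Respects.append {G : Digraph V} {v : V} {p q : Prog V} (hp : p.Respects G v)
    (hq : q.Respects G v) : (p.append q).Respects G v := by
  induction p with
  | done => exact hq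
  | assign x e p ih => exact ih hp
  | send w e p ih => exact ⟨hp.1, ih hp.2⟩
  | recv w x p ih => exact ⟨hp.1, ih hp.2⟩
  | select k g b p _ ih => exact ⟨hp.1, ih hp.2⟩
  | repeat_ k g b p _ ih => exact ⟨hp.1, ih hp.2⟩

theorem Guard.noOutput_of_comm_eq_none {g : Guard V} (h : g.comm = none) : g.NoOutput := by
  simp [NoOutput, h]

theorem Guard.respects_of_comm_eq_none {G : Digraph V} {v : V} {g : Guard V} (h : g.comm = none) :
    g.Respects G v := by
  simp [Respects, h]

theorem Guard.NoOutput.lift {g : Guard V} (h : g.NoOutput) : g.lift.NoOutput := by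
  intro w e
  rcases hg : g.comm with - | ⟨w', x⟩ | ⟨w', e'⟩
  · simp [Guard.lift, hg]
  · simp [Guard.lift, hg]
  · exact (h w' e' hg).elim

theorem Guard.Respects.lift {G : Digraph V} {v : V} {g : Guard V} (h : g.Respects G v) :
    g.lift.Respects G v := by
  rcases hg : g.comm with - | ⟨w', x⟩ | ⟨w', e'⟩
  · exact respects_of_comm_eq_none (by simp [Guard.lift, hg])
  · refine ⟨fun w y hy => ?_, fun w e he => by simp [Guard.lift, hg] at he⟩
    simp only [Guard.lift, hg, Option.some.injEq, GuardComm.input.injEq] at hy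
    exact hy.1 ▸ h.1 _ _ hg
  · refine ⟨fun w y hy => by simp [Guard.lift, hg] at hy, fun w e he => ?_⟩
    simp only [Guard.lift, hg, Option.some.injEq, GuardComm.output.injEq] at he
    exact he.1 ▸ h.2 _ _ hg

theorem Guard.liftBody_inputGuardsOnly {g : Guard V} {Z q : Prog V} (hZ : Z.InputGuardsOnly)
    (hq : q.InputGuardsOnly) : (g.liftBody Z q).InputGuardsOnly := by
  unfold liftBody
  split
  · refine ⟨fun i => ⟨noOutput_of_comm_eq_none rfl, ?_⟩, trivial⟩
    dsimp only
    split
    · exact hq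
    · exact hZ
  · exact hq

theorem Guard.liftBody_respects {G : Digraph V} {v : V} {g : Guard V} {Z q : Prog V}
    (hZ : Z.Respects G v) (hq : q.Respects G v) : (g.liftBody Z q).Respects G v := by
  unfold liftBody
  split
  · refine ⟨fun i => ⟨respects_of_comm_eq_none rfl, ?_⟩, trivial⟩
    dsimp only
    split
    · exact hq
    · exact hZ
  · exact hq

theorem Prog.InputGuardsOnly.lift {p : Prog V} (hp : p.InputGuardsOnly) :
    p.lift.InputGuardsOnly := by
  induction p with
  | done => trivial
  | assign x e p ih => exact ih hp
  | send w e p ih => exact ih hp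
  | recv w x p ih => exact ih hp
  | select k g b p ihb ih =>
    have hb := fun i => ihb i (hp.1 i).2
    have hg := fun i => (hp.1 i).1.lift
    exact ⟨fun i => ⟨hg i, Guard.liftBody_inputGuardsOnly
      ⟨fun j => ⟨hg j, Guard.liftBody_inputGuardsOnly trivial (hb j)⟩, trivial⟩ (hb i)⟩, ih hp.2⟩
  | repeat_ k g b p ihb ih =>
    exact ⟨fun i => ⟨(hp.1 i).1.lift, Guard.liftBody_inputGuardsOnly trivial
      (ihb i (hp.1 i).2)⟩, ih hp.2⟩

theorem Prog.Respects.lift {G : Digraph V} {v : V} {p : Prog V} (hp : p.Respects G v) :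
    p.lift.Respects G v := by
  induction p with
  | done => trivial
  | assign x e p ih => exact ih hp
  | send w e p ih => exact ⟨hp.1, ih hp.2⟩
  | recv w x p ih => exact ⟨hp.1, ih hp.2⟩
  | select k g b p ihb ih =>
    have hb := fun i => ihb i (hp.1 i).2
    have hg := fun i => (hp.1 i).1.lift
    exact ⟨fun i => ⟨hg i, Guard.liftBody_respects
      ⟨fun j => ⟨hg j, Guard.liftBody_respects trivial (hb j)⟩, trivial⟩ (hb i)⟩, ih hp.2⟩
  | repeat_ k g b p ihb ih =>
    exact ⟨fun i => ⟨(hp.1 i).1.lift, Guard.liftBody_respects trivial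
      (ihb i (hp.1 i).2)⟩, ih hp.2⟩

theorem Guard.offer_lift (g : Guard V) (s : Store V) :
    g.lift.offer s = (g.offer s.decode).map Offer.lift := by
  rcases hg : g.comm with - | ⟨w', x⟩ | ⟨w', e'⟩ <;> simp [Guard.lift, Guard.offer, hg, Offer.lift]

theorem offers_lift {k : ℕ} (g : Fin k → Guard V) (s : Store V) :
    offers (fun i => (g i).lift) s = Option.map Offer.lift '' offers g s.decode := by
  ext o
  constructor
  · rintro ⟨i, hi, rfl⟩
    exact ⟨_, ⟨i, hi, rfl⟩, (Guard.offer_lift _ _).symm⟩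
  · rintro ⟨_, ⟨i, hi, rfl⟩, rfl⟩
    exact ⟨i, hi, Guard.offer_lift _ _⟩

/-! ### Renaming -/

variable (σ : V → V)

@[simp] theorem Val.rename_enc (a : Val V) : a.enc.rename σ = (a.rename σ).enc := rfl

@[simp] theorem Val.rename_ofList (l : List V) :
    (Val.ofList l).rename σ = .ofList (l.map σ) := by
  induction l with
  | nil => rfl
  | cons v l ih => simp [Val.ofList, Val.rename, ih]

@[simp] theorem Val.rename_token (l : List V) : (Val.token l).rename σ = .token (l.map σ) := by
  simp [Val.token, Val.rename]

@[simp] theorem Val.isToken_rename (a : Val V) : (a.rename σ).isToken = a.isToken := by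
  rcases a with b | z | v | ⟨(_ | _) | z | v | ⟨a, b⟩, c⟩ <;> rfl

@[simp] theorem Var.rename_tmpVar : (tmpVar : Var V).rename σ = tmpVar := rfl
@[simp] theorem Var.rename_planVar : (planVar : Var V).rename σ = planVar := rfl

@[simp] theorem Var.rename_shift (x : Var V) : x.shift.rename σ = (x.rename σ).shift := by
  cases x <;> rfl

theorem Offer.rename_lift (o : Offer V) : o.lift.rename σ = (o.rename σ).lift := by
  cases o <;> rfl

theorem rename_lift_image (O : Set (Option (Offer V))) :
    Option.map (Offer.rename σ) '' (Option.map Offer.lift '' O) =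
      Option.map Offer.lift '' (Option.map (Offer.rename σ) '' O) := by
  simp only [Set.image_image, Option.map_map]
  congr 1
  funext o
  congr 1
  funext o
  exact Offer.rename_lift σ o

theorem Val.rename_injective {σ : V → V} (hσ : Function.Injective σ) :
    Function.Injective (Val.rename σ) := fun a b h => by
  induction a generalizing b with
  | bool => cases b <;> simp_all [Val.rename]
  | int => cases b <;> simp_all [Val.rename]
  | name v =>
    cases b with
    | name w => simp only [Val.rename, Val.name.injEq] at h ⊢; exact hσ h
    | _ => simp [Val.rename] at h
  | pair a a' ih ih' =>
    cases b with
    | pair b b' =>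
      simp only [Val.rename, Val.pair.injEq] at h ⊢
      exact ⟨ih _ h.1, ih' _ h.2⟩
    | _ => simp [Val.rename] at h

/-- A permutation of a finite vertex set that preserves the edges also reflects them, because its
inverse is one of its powers. -/
theorem IsAutomorphism.adj_iff [Finite V] {G : Digraph V} {σ : Equiv.Perm V}
    (hσ : IsAutomorphism G σ) (a b : V) : G.Adj (σ a) (σ b) ↔ G.Adj a b := by
  refine ⟨fun h => ?_, hσ a b⟩
  have hpow : ∀ n : ℕ, ∀ a b, G.Adj a b → G.Adj ((σ ^ n) a) ((σ ^ n) b) := fun n => by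
    induction n with
    | zero => exact fun a b h => h
    | succ n ih =>
      intro a b h
      rw [pow_succ', Equiv.Perm.mul_apply, Equiv.Perm.mul_apply]
      exact hσ _ _ (ih a b h)
  have h1 := hpow (orderOf σ - 1) _ _ h
  have h2 : σ ^ (orderOf σ - 1) * σ = 1 := by
    rw [← pow_succ, Nat.sub_add_cancel (orderOf_pos σ), pow_orderOf_eq_one]
  have h3 : ∀ x, (σ ^ (orderOf σ - 1)) (σ x) = x := fun x => by
    rw [← Equiv.Perm.mul_apply, h2, Equiv.Perm.one_apply]
  rwa [h3, h3] at h1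

end Lift

/-! ### The token walk -/

section Walk

variable {V : Type u}

/-- The selection with alternatives indexed by an arbitrary finite type. -/
noncomputable def Prog.selectOver {ι : Type*} [Finite ι] (g : ι → Guard V) (b : ι → Prog V)
    (rest : Prog V) : Prog V :=
  .select (Nat.card ι) (fun i => g ((Finite.equivFin ι).symm i))
    (fun i => b ((Finite.equivFin ι).symm i)) rest

/-- A straight-line program that passes on the token (`true`) and receives it (`false`) as
prescribed by a list. -/
def lineProg : List (Bool × V) → Prog V
  | [] => .done
  | (true, b) :: l => .send b (fun s => s planVar) (lineProg l)
  | (false, a) :: l => .recv a planVar (lineProg l)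

/-- The moves of the token along a walk in which `v` takes part. -/
def moves [DecidableEq V] (v : V) : List V → List (Bool × V)
  | [] => []
  | [_] => []
  | a :: b :: l => if a = v then (true, b) :: moves v (b :: l)
      else if b = v then (false, a) :: moves v (b :: l) else moves v (b :: l)

/-- The moves that remain for `v` when the token, following the walk `π`, has reached `v` for the
first time. -/
def movesFrom [DecidableEq V] (v : V) (π : List V) : List (Bool × V) :=
  moves v (π.dropWhile (fun u => u ≠ v))

variable (G : Digraph V) (W : Set (List V))

open Classical in
/-- The guards with which process `v` gets hold of the token when it has completed the election
program: the leader chooses one of the walks in `W` that start from it; any other process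
waits for the token, unless it has received the token already. -/
noncomputable def tokenGuard (v : V) : W ⊕ Option V → Guard V
  | .inl π => ⟨fun s => decide (s.decode .leader = .name v ∧ π.1.head? = some v), none⟩
  | .inr none => ⟨fun s => decide (s.decode .leader ≠ .name v ∧ (s planVar).isToken = true), none⟩
  | .inr (some w) =>
    ⟨fun s => decide (s.decode .leader ≠ .name v ∧ (s planVar).isToken = false ∧ G.Adj w v),
      if G.Adj w v then some (.input w planVar) else none⟩

/-- The alternatives for `tokenGuard`: the leader stores the token that it launches; in the other
cases the token is in `planVar` already. -/
def tokenBody : W ⊕ Option V → Prog V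
  | .inl π => .assign planVar (fun _ => .token π.1) .done
  | .inr _ => .done

open Classical in
/-- Process `v` is visited by the token for the first time and acts according to the walk that the
token carries. -/
noncomputable def dispatch [Finite W] [DecidableEq V] (v : V) : Prog V :=
  .selectOver (ι := W) (fun π => ⟨fun s => decide (s planVar = .token π.1), none⟩)
    (fun π => lineProg (movesFrom v π.1)) .done

/-- The part of process `v` that follows the election. -/
noncomputable def traverse [Finite V] [Finite W] [DecidableEq V] (v : V) : Prog V :=
  .selectOver (tokenGuard G W v) (tokenBody W) (dispatch W v)

/-- The election followed by a walk of a token. -/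
noncomputable def tokenSystem [Finite V] [Finite W] [DecidableEq V] (P : System V) : System V where
  prog v := (P.prog v).lift.append (traverse G W v)

theorem lineProg_inputGuardsOnly (l : List (Bool × V)) : (lineProg l).InputGuardsOnly := by
  induction l with
  | nil => trivial
  | cons c l ih => rcases c with ⟨_ | _, b⟩ <;> exact ih

theorem lineProg_respects {G : Digraph V} {v : V} {l : List (Bool × V)}
    (h : ∀ c ∈ l, if c.1 then G.Adj v c.2 else G.Adj c.2 v) : (lineProg l).Respects G v := by
  induction l with
  | nil => trivial
  | cons c l ih =>
    have h1 := h c List.mem_cons_self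
    have h2 := ih fun c hc => h c (List.mem_cons_of_mem _ hc)
    rcases c with ⟨_ | _, b⟩ <;> simp only [lineProg, Prog.Respects] <;>
      exact ⟨by simpa using h1, h2⟩

theorem adj_of_mem_moves [DecidableEq V] {G : Digraph V} {v : V} {π : List V}
    (h : π.IsChain G.Adj) : ∀ c ∈ moves v π, if c.1 then G.Adj v c.2 else G.Adj c.2 v := by
  induction π with
  | nil => simp [moves]
  | cons a l ih =>
    cases l with
    | nil => simp [moves]
    | cons b l =>
      rw [List.isChain_cons_cons] at h
      intro c hc
      rw [moves] at hc
      split at hc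
      · rcases List.mem_cons.1 hc with rfl | hc
        · simpa using ‹a = v› ▸ h.1
        · exact ih h.2 c hc
      · split at hc
        · rcases List.mem_cons.1 hc with rfl | hc
          · simpa using ‹b = v› ▸ h.1
          · exact ih h.2 c hc
        · exact ih h.2 c hc

theorem Prog.selectOver_inputGuardsOnly {ι : Type*} [Finite ι] {g : ι → Guard V} {b : ι → Prog V}
    {rest : Prog V} (h : ∀ i, (g i).NoOutput ∧ (b i).InputGuardsOnly)
    (hrest : rest.InputGuardsOnly) : (selectOver g b rest).InputGuardsOnly :=
  ⟨fun _ => h _, hrest⟩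

theorem Prog.selectOver_respects {G : Digraph V} {v : V} {ι : Type*} [Finite ι]
    {g : ι → Guard V} {b : ι → Prog V} {rest : Prog V}
    (h : ∀ i, (g i).Respects G v ∧ (b i).Respects G v)
    (hrest : rest.Respects G v) : (selectOver g b rest).Respects G v :=
  ⟨fun _ => h _, hrest⟩

variable {G W} [Finite V] [Finite W] [DecidableEq V]

theorem traverse_inputGuardsOnly (v : V) : (traverse G W v).InputGuardsOnly := by
  refine Prog.selectOver_inputGuardsOnly ?_ (Prog.selectOver_inputGuardsOnly
    (fun π => ⟨Guard.noOutput_of_comm_eq_none rfl, lineProg_inputGuardsOnly _⟩) trivial)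
  rintro (π | _ | w)
  · exact ⟨Guard.noOutput_of_comm_eq_none rfl, trivial⟩
  · exact ⟨Guard.noOutput_of_comm_eq_none rfl, trivial⟩
  · refine ⟨fun w' e => ?_, trivial⟩
    simp only [tokenGuard]
    split <;> simp

theorem traverse_respects (hW : ∀ π ∈ W, π.IsChain G.Adj) (v : V) :
    (traverse G W v).Respects G v := by
  refine Prog.selectOver_respects ?_ (Prog.selectOver_respects
    (fun π => ⟨Guard.respects_of_comm_eq_none rfl, lineProg_respects
      (adj_of_mem_moves ((hW _ π.2).suffix (List.dropWhile_suffix _)))⟩) trivial)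
  rintro (π | _ | w)
  · exact ⟨Guard.respects_of_comm_eq_none rfl, trivial⟩
  · exact ⟨Guard.respects_of_comm_eq_none rfl, trivial⟩
  · by_cases hw : G.Adj w v
    · refine ⟨⟨fun w' x h => ?_, fun w' x h => ?_⟩, trivial⟩
      · simp only [tokenGuard, if_pos hw, Option.some.injEq, GuardComm.input.injEq] at h
        exact h.1 ▸ hw
      · simp [tokenGuard, hw] at h
    · exact ⟨Guard.respects_of_comm_eq_none (by simp [tokenGuard, hw]), trivial⟩

theorem tokenSystem_inCSPin {P : System V} (hP : P.InCSPin) : (tokenSystem G W P).InCSPin :=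
  fun v => (hP v).lift.append (traverse_inputGuardsOnly v)

theorem tokenSystem_admittedBy {P : System V} (hP : P.AdmittedBy G)
    (hW : ∀ π ∈ W, π.IsChain G.Adj) : (tokenSystem G W P).AdmittedBy G :=
  fun v => (hP v).lift.append (traverse_respects hW v)

end Walk

end CSP

/-! ### The local behaviour of the constructed system -/

namespace CSP

section Deterministic

variable {V : Type u} [DecidableEq V]

/-- A sequence of local actions during which the process has no other possible action. -/
inductive DetRun : LocalState V → List (Action V) → LocalState V → Prop
  | nil (q : LocalState V) : DetRun q [] q
  | cons {q q₁ q₂ : LocalState V} {α : Action V} {l : List (Action V)} :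
      α.IsLocal → LocalStep q α q₁ → (∀ β r, LocalStep q β r → β = α ∧ r = q₁) →
      DetRun q₁ l q₂ → DetRun q (α :: l) q₂

theorem DetRun.append {q q₁ q₂ : LocalState V} {l l' : List (Action V)} (h : DetRun q l q₁)
    (h' : DetRun q₁ l' q₂) : DetRun q (l ++ l') q₂ := by
  induction h with
  | nil => exact h'
  | cons h1 h2 h3 _ ih => exact .cons h1 h2 h3 (ih h')

theorem DetRun.eq_of_nil {q q' : LocalState V} (h : DetRun q [] q') : q = q' := by
  cases h
  rfl

theorem detRun_assign (x : Var V) (e : Store V → Val V) (p : Prog V) (s : Store V) :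
    DetRun ⟨.run (.assign x e p), s⟩ [.assign x (e s)] ⟨.run p, Function.update s x (e s)⟩ := by
  refine .cons trivial (.assign x e p s) (fun β r h => ?_) (.nil _)
  cases h
  exact ⟨rfl, rfl⟩

theorem detRun_select {k : ℕ} {g : Fin k → Guard V} {b : Fin k → Prog V} {p : Prog V}
    {s : Store V} (h : ∃ i, (g i).cond s = true) :
    DetRun ⟨.run (.select k g b p), s⟩ [.guards (offers g s)] ⟨.wait k g b p, s⟩ := by
  refine .cons trivial (.select k g b p s h) (fun β r h => ?_) (.nil _)
  cases h
  exact ⟨rfl, rfl⟩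

theorem detRun_repeat {k : ℕ} {g : Fin k → Guard V} {b : Fin k → Prog V} {p : Prog V}
    {s : Store V} (h : ∃ i, (g i).cond s = true) :
    DetRun ⟨.run (.repeat_ k g b p), s⟩ [.guards (offers g s)]
      ⟨.wait k g b (.repeat_ k g b p), s⟩ := by
  refine .cons trivial (.repeat_ k g b p s h) (fun β r h' => ?_) (.nil _)
  cases h' with
  | repeat_ => exact ⟨rfl, rfl⟩
  | exit k g b p s h' =>
    obtain ⟨i, hi⟩ := h
    rw [h' i] at hi
    cases hi

/-- If a single guard is true, and it contains no communication, its alternative is taken. -/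
theorem detRun_choose {k : ℕ} {g : Fin k → Guard V} {b : Fin k → Prog V} {p : Prog V}
    {s : Store V} {i : Fin k} (hi : (g i).cond s = true) (hc : (g i).comm = none)
    (hu : ∀ j, (g j).cond s = true → j = i) :
    DetRun ⟨.wait k g b p, s⟩ [.choose] ⟨.run ((b i).append p), s⟩ := by
  refine .cons trivial (.choose k g b p s i hi hc) (fun β r h => ?_) (.nil _)
  cases h with
  | choose k g b p s j hj _ => exact ⟨rfl, by rw [hu j hj]⟩
  | guardSend k g b p s j hj w e h =>
    rw [hu j hj, hc] at h
    cases h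
  | guardRecv k g b p s j hj w x h =>
    rw [hu j hj, hc] at h
    cases h

theorem detRun_select_choose {k : ℕ} {g : Fin k → Guard V} {b : Fin k → Prog V} {p : Prog V}
    {s : Store V} {i : Fin k} (hi : (g i).cond s = true) (hc : (g i).comm = none)
    (hu : ∀ j, (g j).cond s = true → j = i) :
    DetRun ⟨.run (.select k g b p), s⟩ [.guards {none}, .choose] ⟨.run ((b i).append p), s⟩ := by
  have ho : offers g s = {none} := by
    ext o
    constructor
    · rintro ⟨j, hj, rfl⟩
      rw [hu j hj]
      simp [Guard.offer, hc]
    · rintro rfl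
      exact ⟨i, hi, by simp [Guard.offer, hc]⟩
  have := (detRun_select (b := b) (p := p) ⟨i, hi⟩).append (detRun_choose hi hc hu)
  rwa [ho] at this

theorem detRun_selectOver {ι : Type*} [Finite ι] {g : ι → Guard V} {b : ι → Prog V} {p : Prog V}
    {s : Store V} {i : ι} (hi : (g i).cond s = true) (hc : (g i).comm = none)
    (hu : ∀ j, (g j).cond s = true → j = i) :
    DetRun ⟨.run (.selectOver g b p), s⟩ [.guards {none}, .choose]
      ⟨.run ((b i).append p), s⟩ := by
  have := detRun_select_choose (k := Nat.card ι) (g := fun i => g ((Finite.equivFin ι).symm i))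
    (b := fun i => b ((Finite.equivFin ι).symm i)) (p := p) (s := s) (i := Finite.equivFin ι i)
    (by simpa using hi) (by simpa using hc)
    (fun j hj => by rw [← hu _ hj, Equiv.apply_symm_apply])
  simpa [Prog.selectOver] using this

theorem detRun_screen_enc {Z q p : Prog V} {x : Var V} {s : Store V} {a : Val V}
    (h : s tmpVar = a.enc) :
    DetRun ⟨.run ((Prog.screen Z x q).append p), s⟩
      [.guards {none}, .choose, .assign x.shift a.enc]
      ⟨.run (q.append p), Function.update s x.shift a.enc⟩ := by
  have h1 : DetRun ⟨.run ((Prog.screen Z x q).append p), s⟩ [.guards {none}, .choose]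
      ⟨.run ((Prog.assign x.shift (fun s => s tmpVar) q).append p), s⟩ := by
    refine detRun_select_choose (i := 0) (by simp [h]) rfl fun j hj => ?_
    by_contra hj'
    simp [hj', h] at hj
  have h2 := detRun_assign x.shift (fun s => s tmpVar) (q.append p) s
  rw [h] at h2
  exact h1.append h2

theorem detRun_screen_token {Z q p : Prog V} {x : Var V} {s : Store V} {π : List V}
    (h : s tmpVar = .token π) :
    DetRun ⟨.run ((Prog.screen Z x q).append p), s⟩
      [.guards {none}, .choose, .assign planVar (.token π)]
      ⟨.run (Z.append p), Function.update s planVar (.token π)⟩ := by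
  have h1 : DetRun ⟨.run ((Prog.screen Z x q).append p), s⟩ [.guards {none}, .choose]
      ⟨.run ((Prog.assign planVar (fun s => s tmpVar) Z).append p), s⟩ := by
    refine detRun_select_choose (i := 1) (by simp [h]) rfl fun j hj => ?_
    by_contra hj'
    have : j = 0 := by omega
    simp [this, h] at hj
  have h2 := detRun_assign planVar (fun s => s tmpVar) (Z.append p) s
  rw [h] at h2
  exact h1.append h2

theorem Prog.append_done {V : Type u} (p : Prog V) : p.append .done = p := by
  induction p with
  | done => rfl
  | assign x e p ih => simp only [append, ih]
  | send w e p ih => simp only [append, ih]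
  | recv w x p ih => simp only [append, ih]
  | select k g b p _ ih => simp only [append, ih]
  | repeat_ k g b p _ ih => simp only [append, ih]

theorem detRun_dispatch {W : Set (List V)} [Finite W] {v : V} {s : Store V} {π : List V}
    (hπ : π ∈ W) (h : s planVar = .token π) :
    DetRun ⟨.run (dispatch W v), s⟩ [.guards {none}, .choose]
      ⟨.run (lineProg (movesFrom v π)), s⟩ := by
  have := detRun_selectOver (ι := W)
    (g := fun π => ⟨fun s => (open Classical in decide (s planVar = .token π.1)), none⟩)
    (b := fun π => lineProg (movesFrom v π.1)) (p := .done) (s := s) (i := ⟨π, hπ⟩)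
    (by simp [h]) rfl
    (fun j hj => by
      simp only [h, decide_eq_true_eq] at hj
      exact Subtype.ext (Val.token_injective hj).symm)
  rwa [Prog.append_done] at this

end Deterministic

/-! ### Modes -/

section Modes

variable {V : Type u}

/-- Where a process of the constructed system stands.
* `run pv`: about to run the lifted form of some program;
* `wait pv O`: waiting at lifted guards, the offers of the original guards being `O`;
* `fwait lv`: the election is completed with leader value `lv`, and the process waits for the token,
  or is the leader and about to choose a walk;
* `walk lv t l`: the moves `l` of the token `t` remain.
Here `pv` is the value of `planVar`. -/
inductive Base (V : Type u) : Type u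
  | run (pv : Val V)
  | wait (pv : Val V) (O : Set (Option (Offer V)))
  | fwait (lv : Val V)
  | walk (lv t : Val V) (l : List (Bool × V))

/-- A list of deterministic local actions that are still to be performed, and the base mode that is
reached thereafter. -/
abbrev Mode (V : Type u) : Type u := List (Action V) × Base V

/-- The leader value recorded after the election. -/
def Base.leaderValue : Base V → Option (Val V)
  | .fwait lv => some lv
  | .walk lv _ _ => some lv
  | _ => none

/-- The offers of process `v` when it has completed the election and has not received the token. -/
def startOffers (G : Digraph V) (v : V) (lv : Val V) : Set (Option (Offer V)) :=
  {o | (lv = .name v ∧ o = none) ∨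
    (lv ≠ .name v ∧ ∃ w, G.Adj w v ∧ o = some (.input w planVar))}

variable [DecidableEq V]

/-- `Trans G W v m α β m'`: process `v` of the constructed system passes from mode `m` to mode `m'`
by the action `α`, while the original process performs `β` or nothing. The relation does not refer
to programs, which need not be symmetric. -/
inductive Trans (G : Digraph V) (W : Set (List V)) (v : V) :
    Mode V → Action V → Option (Action V) → Mode V → Prop
  | pending {α : Action V} (l : List (Action V)) (b : Base V) (hα : α.IsLocal) :
      Trans G W v (α :: l, b) α none (l, b)
  | assign (pv : Val V) (x : Var V) (a : Val V) :
      Trans G W v ([], .run pv) (.assign x.shift a.enc) (some (.assign x a)) ([], .run pv)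
  | send (pv : Val V) (w : V) (a : Val V) :
      Trans G W v ([], .run pv) (.send w a.enc) (some (.send w a)) ([], .run pv)
  | recv (pv : Val V) (w : V) (x : Var V) (a : Val V) :
      Trans G W v ([], .run pv) (.recv w x.shift a.enc) (some (.recv w x a)) ([], .run pv)
  | guards (pv : Val V) (O : Set (Option (Offer V))) :
      Trans G W v ([], .run pv) (.guards (Option.map Offer.lift '' O)) (some (.guards O))
        ([], .wait pv O)
  | exit (pv : Val V) : Trans G W v ([], .run pv) .exit (some .exit) ([], .run pv)
  | choose (pv : Val V) (O : Set (Option (Offer V))) :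
      Trans G W v ([], .wait pv O) .choose (some .choose) ([], .run pv)
  | guardRecv (pv : Val V) (O : Set (Option (Offer V))) (w : V) (x : Var V) (a : Val V) :
      Trans G W v ([], .wait pv O) (.recv w tmpVar a.enc) (some (.recv w x a))
        ([.guards {none}, .choose, .assign x.shift a.enc], .run pv)
  | poll {pv : Val V} {O : Set (Option (Offer V))} {w : V} {x : Var V} {π : List V}
      (hpv : pv.isToken = false) (hO : some (.input w x) ∈ O) (hπ : π ∈ W) :
      Trans G W v ([], .wait pv O) (.recv w tmpVar (.token π)) none
        ([.guards {none}, .choose, .assign planVar (.token π),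
          .guards (Option.map Offer.lift '' O)], .wait (.token π) O)
  | start {pv lv : Val V} (hpv : pv.isToken = false) (ho : (startOffers G v lv).Nonempty) :
      Trans G W v ([], .run pv) (.guards (startOffers G v lv)) none ([], .fwait lv)
  | startPolled {lv : Val V} {π : List V} (hπ : π ∈ W) (hlv : lv ≠ .name v) :
      Trans G W v ([], .run (.token π)) (.guards {none}) none
        ([.choose, .guards {none}, .choose], .walk lv (.token π) (movesFrom v π))
  | launch {π : List V} (hπ : π ∈ W) (hv : π.head? = some v) :
      Trans G W v ([], .fwait (.name v)) .choose none
        ([.assign planVar (.token π), .guards {none}, .choose],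
          .walk (.name v) (.token π) (movesFrom v π))
  | receive {lv : Val V} {w : V} {π : List V} (hlv : lv ≠ .name v) (hw : G.Adj w v) (hπ : π ∈ W) :
      Trans G W v ([], .fwait lv) (.recv w planVar (.token π)) none
        ([.guards {none}, .choose], .walk lv (.token π) (movesFrom v π))
  | walkSend (lv t : Val V) (b : V) (l : List (Bool × V)) :
      Trans G W v ([], .walk lv t ((true, b) :: l)) (.send b t) none ([], .walk lv t l)
  | walkRecv (lv t : Val V) (a : V) (l : List (Bool × V)) :
      Trans G W v ([], .walk lv t ((false, a) :: l)) (.recv a planVar t) none ([], .walk lv t l)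

theorem Trans.leaderValue {G : Digraph V} {W : Set (List V)} {v : V} {m m' : Mode V} {α : Action V}
    {β : Option (Action V)} (h : Trans G W v m α β m') {lv : Val V}
    (hlv : m.2.leaderValue = some lv) : m'.2.leaderValue = some lv := by
  cases h <;> first | exact hlv | cases hlv

theorem Trans.leaderValue_eq_none {G : Digraph V} {W : Set (List V)} {v : V} {m m' : Mode V}
    {α β : Action V} (h : Trans G W v m α (some β) m') :
    m.2.leaderValue = none ∧ m'.2.leaderValue = none := by
  cases h <;> exact ⟨rfl, rfl⟩

/-! ### Renaming of modes -/

/-- The base mode with all process names changed via `σ`. -/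
def Base.rename (σ : V → V) : Base V → Base V
  | .run pv => .run (pv.rename σ)
  | .wait pv O => .wait (pv.rename σ) (Option.map (Offer.rename σ) '' O)
  | .fwait lv => .fwait (lv.rename σ)
  | .walk lv t l => .walk (lv.rename σ) (t.rename σ) (l.map fun c => (c.1, σ c.2))

/-- The mode with all process names changed via `σ`. -/
def Mode.rename (σ : V → V) (m : Mode V) : Mode V :=
  (m.1.map (Action.rename σ), m.2.rename σ)

theorem Base.leaderValue_rename {V : Type u} (σ : V → V) (b : Base V) :
    (b.rename σ).leaderValue = b.leaderValue.map (Val.rename σ) := by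
  cases b <;> rfl

theorem moves_rename {σ : V → V} (hσ : Function.Injective σ) (v : V) (π : List V) :
    moves (σ v) (π.map σ) = (moves v π).map fun c => (c.1, σ c.2) := by
  induction π with
  | nil => rfl
  | cons a l ih =>
    cases l with
    | nil => rfl
    | cons b l =>
      simp only [List.map_cons, moves, hσ.eq_iff] at ih ⊢
      split
      · simp [ih]
      · split <;> simp [ih]

theorem movesFrom_rename {σ : V → V} (hσ : Function.Injective σ) (v : V) (π : List V) :
    movesFrom (σ v) (π.map σ) = (movesFrom v π).map fun c => (c.1, σ c.2) := by
  have : ((fun u => decide (u ≠ σ v)) ∘ σ) = fun u => decide (u ≠ v) := by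
    funext u
    simp [hσ.eq_iff]
  rw [movesFrom, List.dropWhile_map, this, moves_rename hσ, movesFrom]

theorem startOffers_rename {V : Type u} [Finite V] {G : Digraph V} {σ : Equiv.Perm V}
    (hσ : IsAutomorphism G σ) (v : V) (lv : Val V) :
    Option.map (Offer.rename σ) '' startOffers G v lv = startOffers G (σ v) (lv.rename σ) := by
  have hlv : lv.rename σ = .name (σ v) ↔ lv = .name v :=
    (Val.rename_injective σ.injective).eq_iff (b := .name v)
  ext o
  simp only [startOffers, Set.mem_image, Set.mem_ofPred_eq, hlv, ne_eq]
  constructor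
  · rintro ⟨o, ⟨h, rfl⟩ | ⟨h, w, hw, rfl⟩, rfl⟩
    · exact .inl ⟨h, rfl⟩
    · exact .inr ⟨h, σ w, hσ _ _ hw, rfl⟩
  · rintro (⟨h, rfl⟩ | ⟨h, w, hw, rfl⟩)
    · exact ⟨none, .inl ⟨h, rfl⟩, rfl⟩
    · obtain ⟨w, rfl⟩ := σ.surjective w
      exact ⟨_, .inr ⟨h, w, (hσ.adj_iff w v).1 hw, rfl⟩, rfl⟩

/-- Automorphisms of the network map transitions to transitions. -/
theorem Trans.rename [Finite V] {G : Digraph V} {W : Set (List V)} {σ : Equiv.Perm V}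
    (hσ : IsAutomorphism G σ) (hW : ∀ π ∈ W, π.map σ ∈ W) {v : V} {m m' : Mode V} {α : Action V}
    {β : Option (Action V)} (h : Trans G W v m α β m') :
    Trans G W (σ v) (m.rename σ) (α.rename σ) (β.map (Action.rename σ)) (m'.rename σ) := by
  have hn : ∀ {lv : Val V}, lv ≠ .name v → lv.rename σ ≠ .name (σ v) := fun hlv h' =>
    hlv ((Val.rename_injective σ.injective).eq_iff (b := .name v) |>.1 h')
  cases h with
  | pending l b hα =>
    exact .pending _ _ (by cases α <;> simp_all [Action.rename, Action.IsLocal])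
  | assign pv x a =>
    simpa [Mode.rename, Base.rename, Action.rename] using
      Trans.assign (G := G) (W := W) (v := σ v) (pv.rename σ) (x.rename σ) (a.rename σ)
  | send pv w a => exact .send _ _ _
  | recv pv w x a =>
    simpa [Mode.rename, Base.rename, Action.rename] using
      Trans.recv (G := G) (W := W) (v := σ v) (pv.rename σ) (σ w) (x.rename σ) (a.rename σ)
  | guards pv O =>
    simpa only [Mode.rename, Base.rename, Action.rename, rename_lift_image, List.map_nil,
      Option.map_some] using Trans.guards (G := G) (W := W) (v := σ v) (pv.rename σ)
        (Option.map (Offer.rename σ) '' O)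
  | exit pv => exact .exit _
  | choose pv O => exact .choose _ _
  | guardRecv pv O w x a =>
    simpa [Mode.rename, Base.rename, Action.rename] using
      Trans.guardRecv (G := G) (W := W) (v := σ v) (pv.rename σ)
        (Option.map (Offer.rename σ) '' O) (σ w) (x.rename σ) (a.rename σ)
  | @poll pv O w x π hpv hO hπ =>
    have := Trans.poll (G := G) (W := W) (v := σ v) (pv := pv.rename σ) (π := π.map σ)
      (O := Option.map (Offer.rename σ) '' O) (w := σ w) (x := x.rename σ)
      (by simpa using hpv) ⟨_, hO, rfl⟩ (hW _ hπ)
    simpa only [Mode.rename, Base.rename, Action.rename, ← rename_lift_image, List.map_cons,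
      List.map_nil, Val.rename_token, Var.rename_planVar, Var.rename_tmpVar, Set.image_singleton,
      Option.map_none] using this
  | @start pv lv hpv ho =>
    have := Trans.start (G := G) (W := W) (v := σ v) (pv := pv.rename σ) (lv := lv.rename σ)
      (by simpa using hpv) (by rw [← startOffers_rename hσ]; exact ho.image _)
    simpa only [Mode.rename, Base.rename, Action.rename, startOffers_rename hσ, List.map_nil,
      Option.map_none] using this
  | @startPolled lv π hπ hlv =>
    have := Trans.startPolled (G := G) (v := σ v) (hW _ hπ) (hn hlv)
    simpa [Mode.rename, Base.rename, Action.rename, movesFrom_rename σ.injective] using this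
  | launch hπ hv =>
    have := Trans.launch (G := G) (v := σ v) (hW _ hπ) (by simp [hv])
    simpa [Mode.rename, Base.rename, Action.rename, movesFrom_rename σ.injective, Val.rename]
      using this
  | receive hlv hw hπ =>
    have := Trans.receive (v := σ v) (hn hlv) (hσ _ _ hw) (hW _ hπ)
    simpa [Mode.rename, Base.rename, Action.rename, movesFrom_rename σ.injective] using this
  | walkSend lv t b l => exact .walkSend _ _ _ _
  | walkRecv lv t b l => exact .walkRecv _ _ _ _

end Modes

end CSP

/-! ### Local simulation -/

namespace CSP

section Simulation

variable {V : Type u}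

/-- Running `Z`, followed by `q`, leads to the evaluation of the guards `g` and to the choice
between the bodies `b`, which are followed by `q`. -/
def Retry (k : ℕ) (g : Fin k → Guard V) (b : Fin k → Prog V) (q Z : Prog V) : Prop :=
  Z.append q = .select k g b q ∨
    ∃ r, Z.append q = .repeat_ k g b r ∧ q = .repeat_ k g b r

theorem Retry.detRun [DecidableEq V] {k : ℕ} {g : Fin k → Guard V} {b : Fin k → Prog V}
    {q Z : Prog V} (h : Retry k g b q Z) {s : Store V} (hs : ∃ i, (g i).cond s = true) :
    DetRun ⟨.run (Z.append q), s⟩ [.guards (offers g s)] ⟨.wait k g b q, s⟩ := by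
  rcases h with h | ⟨r, h, h'⟩
  · rw [h]
    exact detRun_select hs
  · rw [h, h']
    exact detRun_repeat hs

variable (G : Digraph V) (W : Set (List V)) [Finite V] [Finite W] [DecidableEq V]

/-- The states of the original process and of process `v` of the constructed system that correspond
to each other in a given base mode. -/
inductive Base.Sim (v : V) : LocalState V → LocalState V → Base V → Prop
  | run {p : Prog V} {s s₀ : Store V} {pv : Val V} (hp : p.InputGuardsOnly) (hs : s.decode = s₀)
      (hpv : s planVar = pv) :
      Sim v ⟨.run p, s₀⟩ ⟨.run (p.lift.append (traverse G W v)), s⟩ (.run pv)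
  | wait {k : ℕ} {g : Fin k → Guard V} {b : Fin k → Prog V} {p Z : Prog V} {s s₀ : Store V}
      {pv : Val V} {O : Set (Option (Offer V))}
      (hb : ∀ i, (g i).NoOutput ∧ (b i).InputGuardsOnly) (hp : p.InputGuardsOnly)
      (hs : s.decode = s₀) (hpv : s planVar = pv) (hO : O = offers g s₀)
      (hex : ∃ i, (g i).cond s₀ = true)
      (hZ : pv.isToken = false → Retry k (fun i => (g i).lift)
        (fun i => (g i).liftBody .done (b i).lift) (p.lift.append (traverse G W v)) Z) :
      Sim v ⟨.wait k g b p, s₀⟩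
        ⟨.wait k (fun i => (g i).lift) (fun i => (g i).liftBody Z (b i).lift)
          (p.lift.append (traverse G W v)), s⟩ (.wait pv O)
  | fwait {s s₀ : Store V} {lv : Val V} (hs : s.decode = s₀) (hlv : s₀ .leader = lv)
      (hpv : (s planVar).isToken = false) :
      Sim v ⟨.run .done, s₀⟩
        ⟨.wait (Nat.card (W ⊕ Option V))
          (fun i => tokenGuard G W v ((Finite.equivFin (W ⊕ Option V)).symm i))
          (fun i => tokenBody W ((Finite.equivFin (W ⊕ Option V)).symm i)) (dispatch W v), s⟩
        (.fwait lv)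
  | walk {s s₀ : Store V} {lv t : Val V} {l : List (Bool × V)} (hlv : s₀ .leader = lv)
      (ht : s planVar = t) :
      Sim v ⟨.run .done, s₀⟩ ⟨.run (lineProg l), s⟩ (.walk lv t l)

/-- The states of the original process and of process `v` of the constructed system that correspond
to each other in a given mode. -/
def Mode.Sim (v : V) (q r : LocalState V) (m : Mode V) : Prop :=
  ∃ r', DetRun r m.1 r' ∧ Base.Sim G W v q r' m.2

variable {G W}

theorem Base.Sim.mode {v : V} {q r : LocalState V} {b : Base V} (h : Base.Sim G W v q r b) :
    Mode.Sim G W v q r ([], b) :=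
  ⟨r, .nil r, h⟩

theorem Mode.Sim.base {v : V} {q r : LocalState V} {b : Base V}
    (h : Mode.Sim G W v q r ([], b)) : Base.Sim G W v q r b := by
  obtain ⟨r', h1, h2⟩ := h
  exact h1.eq_of_nil ▸ h2

theorem Mode.Sim.done_of_leaderValue {v : V} {q r : LocalState V} {m : Mode V}
    (h : Mode.Sim G W v q r m) {lv : Val V} (hlv : m.2.leaderValue = some lv) :
    q.Done ∧ q.store .leader = lv := by
  obtain ⟨r', -, h⟩ := h
  obtain ⟨l, b⟩ := m
  cases h <;> cases hlv
  · exact ⟨rfl, ‹_›⟩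
  · exact ⟨rfl, ‹_›⟩

/-- With pending actions only the first of these is possible. -/
theorem Mode.Sim.eq_of_pending {v : V} {q r r' : LocalState V} {α β : Action V}
    {l : List (Action V)} {b : Base V} (h : Mode.Sim G W v q r (α :: l, b))
    (hs : LocalStep r β r') : β = α ∧ α.IsLocal ∧ Mode.Sim G W v q r' (l, b) := by
  obtain ⟨r₁, h1, h2⟩ := h
  cases h1 with
  | cons ha _ hu hr =>
    obtain ⟨rfl, rfl⟩ := hu _ _ hs
    exact ⟨rfl, ha, _, hr, h2⟩

/-- The guards of `traverse` before the token has arrived. -/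
theorem offers_tokenGuard {V : Type u} {G : Digraph V} {W : Set (List V)} [Finite V] [Finite W]
    {v : V} {s : Store V} (hpv : (s planVar).isToken = false)
    (h : s.decode .leader = .name v → ∃ π ∈ W, π.head? = some v) :
    offers (fun i => tokenGuard G W v ((Finite.equivFin (W ⊕ Option V)).symm i)) s =
      startOffers G v (s.decode .leader) := by
  ext o
  constructor
  · rintro ⟨i, hi, rfl⟩
    dsimp only at hi ⊢
    generalize (Finite.equivFin (W ⊕ Option V)).symm i = j at hi ⊢
    rcases j with π | _ | w
    · simp only [tokenGuard, decide_eq_true_eq] at hi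
      exact .inl ⟨hi.1, rfl⟩
    · simp [tokenGuard, hpv] at hi
    · simp only [tokenGuard, decide_eq_true_eq] at hi
      exact .inr ⟨hi.1, w, hi.2.2, by simp [Guard.offer, tokenGuard, hi.2.2]⟩
  · rintro (⟨h', rfl⟩ | ⟨h', w, hw, rfl⟩)
    · obtain ⟨π, hπ, hv⟩ := h h'
      exact ⟨Finite.equivFin _ (.inl ⟨π, hπ⟩), by simp [tokenGuard, h', hv],
        by simp [Guard.offer, tokenGuard]⟩
    · exact ⟨Finite.equivFin _ (.inr (some w)), by simp [tokenGuard, h', hpv, hw],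
        by simp [Guard.offer, tokenGuard, hw]⟩

theorem detRun_traverse_polled {v : V} {s : Store V} {π : List V} (hπ : π ∈ W)
    (hpv : s planVar = .token π) (hlv : s.decode .leader ≠ .name v) :
    DetRun ⟨.run (traverse G W v), s⟩ [.guards {none}, .choose, .guards {none}, .choose]
      ⟨.run (lineProg (movesFrom v π)), s⟩ := by
  have h1 := detRun_selectOver (g := tokenGuard G W v) (b := tokenBody W) (p := dispatch W v)
    (s := s) (i := .inr none) (by simp [tokenGuard, hpv, hlv]) rfl (fun j hj => by
      rcases j with π | _ | w
      · simp [tokenGuard, hlv] at hj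
      · rfl
      · simp [tokenGuard, hpv] at hj)
  exact h1.append (detRun_dispatch hπ hpv)

/-- What the original process does, if anything. -/
def OptStep (q : LocalState V) : Option (Action V) → LocalState V → Prop
  | none, q' => q' = q
  | some β, q' => LocalStep q β q'

theorem DetRun.tail {V : Type u} [DecidableEq V] {q q' : LocalState V} {α : Action V}
    {l : List (Action V)} (h : DetRun q (α :: l) q') {β : Action V} {r : LocalState V} (hs : LocalStep q β r) :
    β = α ∧ DetRun r l q' := by
  cases h with
  | cons _ _ hu hr =>
    obtain ⟨rfl, rfl⟩ := hu _ _ hs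
    exact ⟨rfl, hr⟩

/-- Each local step of the constructed system is a transition. -/
theorem Mode.Sim.exists_of_isLocal {v : V} {q r r' : LocalState V} {m : Mode V} {α : Action V}
    (h : Mode.Sim G W v q r m)
    (hpv : ∀ pv, m = ([], .run pv) → q.Done → pv.isToken = true →
      q.store .leader ≠ .name v ∧ ∃ π ∈ W, pv = .token π)
    (hW : ∃ π ∈ W, π.head? = some v)
    (hs : LocalStep r α r') (hα : α.IsLocal) :
    ∃ β q' m', Trans G W v m α β m' ∧ OptStep q β q' ∧ (∀ b ∈ β, b.IsLocal) ∧
      Mode.Sim G W v q' r' m' := by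
  obtain ⟨_ | ⟨α', l⟩, b⟩ := m
  swap
  · obtain ⟨rfl, hα', h'⟩ := h.eq_of_pending hs
    exact ⟨none, q, _, .pending l b hα', rfl, by simp, h'⟩
  replace h := h.base
  cases h with
  | @run p s s₀ pv hp hsd hspv =>
    subst hsd
    cases p with
    | done =>
      rcases htok : pv.isToken with _ | _
      · have hs' : LocalStep ⟨.run (traverse G W v), s⟩ α r' := hs
        cases hs' with
        | select _ _ _ _ _ hex =>
          subst hspv
          have ho := offers_tokenGuard (G := G) (W := W) (v := v) htok (fun _ => hW)
          rw [ho]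
          refine ⟨none, _, _, .start htok ?_, rfl, by simp, (Base.Sim.fwait rfl rfl htok).mode⟩
          rw [← ho]
          obtain ⟨i, hi⟩ := hex
          exact ⟨_, i, hi, rfl⟩
      · obtain ⟨hlv, π, hπ, rfl⟩ := hpv pv rfl rfl htok
        obtain ⟨rfl, h2⟩ := (detRun_traverse_polled hπ hspv hlv).tail hs
        exact ⟨none, _, _, .startPolled hπ hlv, rfl, by simp, _, h2, .walk rfl hspv⟩
    | assign x e p =>
      cases hs
      exact ⟨_, _, _, .assign pv x (e s.decode), .assign _ _ _ _, by simp [Action.IsLocal],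
        (Base.Sim.run (p := p) hp (by simp)
          (by simpa [Function.update_of_ne, Ne.symm] using hspv)).mode⟩
    | send w e p => cases hs; exact hα.elim
    | recv w x p => cases hs; exact hα.elim
    | select k g b p =>
      cases hs with
      | select _ _ _ _ _ hex =>
        rw [offers_lift]
        exact ⟨_, _, _, .guards pv _, .select _ _ _ _ _ hex, by simp [Action.IsLocal],
          (Base.Sim.wait (p := p) (Z := .select k (fun j => (g j).lift)
            (fun j => (g j).liftBody .done (b j).lift) .done) hp.1 hp.2 rfl hspv rfl hex
            fun _ => .inl rfl).mode⟩
    | repeat_ k g b p =>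
      cases hs with
      | repeat_ _ _ _ _ _ hex =>
        rw [offers_lift]
        exact ⟨_, _, _, .guards pv _, .repeat_ _ _ _ _ _ hex, by simp [Action.IsLocal],
          (Base.Sim.wait (p := .repeat_ k g b p) (Z := .done) hp.1 hp rfl hspv rfl hex
            fun _ => .inr ⟨_, rfl, rfl⟩).mode⟩
      | exit _ _ _ _ _ hex =>
        exact ⟨_, _, _, .exit pv, .exit _ _ _ _ _ hex, by simp [Action.IsLocal],
          (Base.Sim.run (p := p) hp.2 rfl hspv).mode⟩
  | @wait k g b p Z s s₀ pv O hb hp hsd hspv hO hex hZ =>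
    subst hsd
    cases hs with
    | choose _ _ _ _ _ i hc hi =>
      have hi' : (g i).comm = none := by
        rcases hg : (g i).comm with _ | ⟨w, x⟩ | ⟨w, e⟩
        · rfl
        · simp [Guard.lift, hg] at hi
        · simp [Guard.lift, hg] at hi
      refine ⟨_, _, _, .choose pv O, .choose _ _ _ _ _ i hc hi', by simp [Action.IsLocal], ?_⟩
      have : (g i).liftBody Z (b i).lift = (b i).lift := by simp [Guard.liftBody, hi']
      dsimp only
      rw [this, ← Prog.append_assoc, ← Prog.lift_append]
      exact (Base.Sim.run ((hb i).2.append hp) rfl hspv).mode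
    | guardSend => exact hα.elim
    | guardRecv => exact hα.elim
  | @fwait s s₀ lv hsd hlv hspv =>
    subst hsd
    cases hs with
    | choose _ _ _ _ _ i hc hi =>
      dsimp only at hc hi ⊢
      generalize (Finite.equivFin (W ⊕ Option V)).symm i = j at hc hi ⊢
      rcases j with ⟨π, hπ⟩ | _ | w
      · simp only [tokenGuard, decide_eq_true_eq] at hc
        obtain rfl : lv = .name v := hlv.symm.trans hc.1
        refine ⟨none, _, _, .launch hπ hc.2, rfl, by simp, _,
          (detRun_assign planVar (fun _ => .token π) (dispatch W v) s).append
            (detRun_dispatch hπ (by simp)), .walk hlv (by simp)⟩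
      · simp [tokenGuard, hspv] at hc
      · simp only [tokenGuard, decide_eq_true_eq] at hc
        simp [tokenGuard, hc.2.2] at hi
    | guardSend => exact hα.elim
    | guardRecv => exact hα.elim
  | @walk s s₀ lv t l hlv ht =>
    rcases l with _ | ⟨⟨_ | _, c⟩, l⟩
    · cases hs
    · cases hs; exact hα.elim
    · cases hs; exact hα.elim

/-- Outputs are those of the election program, which are never guards, and those by which the token
moves. -/
theorem Mode.Sim.of_send {v w : V} {q r r' : LocalState V} {m : Mode V} {c : Val V}
    (h : Mode.Sim G W v q r m) (hs : LocalStep r (.send w c) r') :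
    (∃ pv a q', m = ([], .run pv) ∧ c = a.enc ∧ LocalStep q (.send w a) q' ∧ q.CommittedTo w ∧
      Mode.Sim G W v q' r' m) ∨
    ∃ lv l, m = ([], .walk lv c ((true, w) :: l)) ∧ Mode.Sim G W v q r' ([], .walk lv c l) := by
  obtain ⟨_ | ⟨α', l⟩, b⟩ := m
  swap
  · obtain ⟨rfl, hα', h'⟩ := h.eq_of_pending hs
    exact hα'.elim
  replace h := h.base
  cases h with
  | @run p s s₀ pv hp hsd hspv =>
    subst hsd
    cases p with
    | send w e p =>
      cases hs
      exact .inl ⟨pv, _, _, rfl, rfl, .send _ _ _ _, .inl ⟨_, _, rfl⟩,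
        (Base.Sim.run (p := p) hp rfl hspv).mode⟩
    | _ => cases hs
  | @wait k g b p Z s s₀ pv O hb hp hsd hspv hO hex hZ =>
    cases hs with
    | guardSend _ _ _ _ _ i hc _ e hi => exact ((hb i).1.lift _ _ hi).elim
  | @fwait s s₀ lv hsd hlv hspv =>
    cases hs with
    | guardSend _ _ _ _ _ i hc _ e hi =>
      dsimp only at hc hi ⊢
      generalize (Finite.equivFin (W ⊕ Option V)).symm i = j at hc hi ⊢
      rcases j with ⟨π, hπ⟩ | _ | w
      · simp [tokenGuard] at hi
      · simp [tokenGuard] at hi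
      · simp only [tokenGuard] at hi
        split at hi <;> simp at hi
  | @walk s s₀ lv t l hlv ht =>
    rcases l with _ | ⟨⟨_ | _, c⟩, l⟩
    · cases hs
    · cases hs
    · cases hs
      subst ht
      exact .inr ⟨lv, l, rfl, (Base.Sim.walk hlv rfl).mode⟩

/-- The reception of a tagged value is a transition, unless the process has completed the
election. -/
theorem Mode.Sim.of_recv_enc {v w : V} {q r r' : LocalState V} {m : Mode V} {x : Var V} {a : Val V}
    (h : Mode.Sim G W v q r m) (hs : LocalStep r (.recv w x a.enc) r') :
    q.Done ∨ ∃ y q' pv l, (m = ([], .run pv) ∨ ∃ O, m = ([], .wait pv O)) ∧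
      Trans G W v m (.recv w x a.enc) (some (.recv w y a)) (l, .run pv) ∧
      LocalStep q (.recv w y a) q' ∧ Mode.Sim G W v q' r' (l, .run pv) := by
  obtain ⟨_ | ⟨α', l⟩, b⟩ := m
  swap
  · obtain ⟨rfl, hα', h'⟩ := h.eq_of_pending hs
    exact hα'.elim
  replace h := h.base
  cases h with
  | @run p s s₀ pv hp hsd hspv =>
    subst hsd
    cases p with
    | recv w x p =>
      cases hs
      exact .inr ⟨x, _, pv, [], .inl rfl, .recv _ _ _ _, .recv _ _ _ _ _,
        (Base.Sim.run (p := p) hp (by simp)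
          (by simpa [Function.update_of_ne, Ne.symm] using hspv)).mode⟩
    | done => exact .inl rfl
    | _ => cases hs
  | @wait k g b p Z s s₀ pv O hb hp hsd hspv hO hex hZ =>
    subst hsd
    cases hs with
    | guardRecv _ _ _ _ _ i hc _ _ hi _ =>
      rcases hg : (g i).comm with _ | ⟨w', y⟩ | ⟨w', e⟩
      · simp [Guard.lift, hg] at hi
      · simp only [Guard.lift, hg, Option.some.injEq, GuardComm.input.injEq] at hi
        obtain ⟨rfl, rfl⟩ := hi
        refine .inr ⟨y, _, pv, _, .inr ⟨O, rfl⟩, .guardRecv _ _ _ y _,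
          .guardRecv _ _ _ _ _ i hc _ _ hg a, ?_⟩
        have : (g i).liftBody Z (b i).lift = .screen Z y (b i).lift := by
          simp [Guard.liftBody, hg]
        dsimp only
        rw [this]
        refine ⟨_, detRun_screen_enc (by simp), ?_⟩
        rw [← Prog.append_assoc, ← Prog.lift_append]
        exact .run ((hb i).2.append hp) (by simp)
          (by simpa [Function.update_of_ne, Ne.symm] using hspv)
      · simp [Guard.lift, hg] at hi
  | @fwait s s₀ lv hsd hlv hspv => exact .inl rfl
  | @walk s s₀ lv t l hlv ht => exact .inl rfl

/-- What a process does when it has received the token at a guard of the election program. -/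
def pollPending {V : Type u} (π : List V) (O : Set (Option (Offer V))) : List (Action V) :=
  [.guards {none}, .choose, .assign planVar (.token π), .guards (Option.map Offer.lift '' O)]

/-- The possibilities for a process to receive the token. -/
theorem Mode.Sim.of_recv_token {v w : V} {q r r' : LocalState V} {m : Mode V} {x : Var V}
    {π : List V} (h : Mode.Sim G W v q r m) (hπ : π ∈ W)
    (hs : LocalStep r (.recv w x (.token π)) r') :
    q.CommittedTo w ∨
    (∃ pv O, m = ([], .wait pv O) ∧ (pv.isToken = false →
      Trans G W v m (.recv w x (.token π)) none (pollPending π O, .wait (.token π) O) ∧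
      Mode.Sim G W v q r' (pollPending π O, .wait (.token π) O))) ∨
    (∃ lv l, m = ([], .fwait lv) ∧
      Trans G W v m (.recv w x (.token π)) none (l, .walk lv (.token π) (movesFrom v π)) ∧
      Mode.Sim G W v q r' (l, .walk lv (.token π) (movesFrom v π))) ∨
    (∃ lv t l, m = ([], .walk lv t ((false, w) :: l)) ∧ (t = .token π →
      Trans G W v m (.recv w x (.token π)) none ([], .walk lv t l) ∧
      Mode.Sim G W v q r' ([], .walk lv t l))) := by
  obtain ⟨_ | ⟨α', l⟩, b⟩ := m
  swap
  · obtain ⟨rfl, hα', h'⟩ := h.eq_of_pending hs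
    exact hα'.elim
  replace h := h.base
  cases h with
  | @run p s s₀ pv hp hsd hspv =>
    subst hsd
    cases p with
    | recv w x p =>
      cases hs
      exact .inl (.inr ⟨_, _, rfl⟩)
    | done =>
      have hs' : LocalStep ⟨.run (traverse G W v), s⟩ (.recv w x (.token π)) r' := hs
      cases hs'
    | _ => cases hs
  | @wait k g b p Z s s₀ pv O hb hp hsd hspv hO hex hZ =>
    subst hsd
    refine .inr (.inl ⟨pv, O, rfl, fun hpv => ?_⟩)
    cases hs with
    | guardRecv _ _ _ _ _ i hc _ _ hi _ =>
      rcases hg : (g i).comm with _ | ⟨w', y⟩ | ⟨w', e⟩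
      · simp [Guard.lift, hg] at hi
      · simp only [Guard.lift, hg, Option.some.injEq, GuardComm.input.injEq] at hi
        obtain ⟨rfl, rfl⟩ := hi
        refine ⟨.poll (x := y) hpv ?_ hπ, ?_⟩
        · rw [hO]
          exact ⟨i, hc, by simp [Guard.offer, hg]⟩
        have : (g i).liftBody Z (b i).lift = .screen Z y (b i).lift := by
          simp [Guard.liftBody, hg]
        dsimp only
        rw [this]
        have h1 := detRun_screen_token (Z := Z) (x := y) (q := (b i).lift)
          (p := p.lift.append (traverse G W v))
          (s := Function.update s tmpVar (.token π)) (π := π) (by simp)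
        have h2 := (hZ hpv).detRun
          (s := Function.update (Function.update s tmpVar (.token π)) planVar (.token π))
          (by simpa [Guard.lift] using hex)
        rw [offers_lift, Store.decode_update_planVar, Store.decode_update_tmpVar, ← hO] at h2
        exact ⟨_, h1.append h2, .wait hb hp (by simp) (by simp) hO hex (by simp)⟩
      · simp [Guard.lift, hg] at hi
  | @fwait s s₀ lv hsd hlv hspv =>
    subst hsd
    cases hs with
    | guardRecv _ _ _ _ _ i hc _ _ hi _ =>
      dsimp only at hc hi ⊢
      generalize (Finite.equivFin (W ⊕ Option V)).symm i = j at hc hi ⊢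
      rcases j with ⟨π, hπ⟩ | _ | w
      · simp [tokenGuard] at hi
      · simp [tokenGuard] at hi
      · simp only [tokenGuard, decide_eq_true_eq] at hc
        simp only [tokenGuard, if_pos hc.2.2, Option.some.injEq, GuardComm.input.injEq] at hi
        obtain ⟨rfl, rfl⟩ := hi
        refine .inr (.inr (.inl ⟨lv, _, rfl, .receive (hlv ▸ hc.1) hc.2.2 hπ, _,
          detRun_dispatch hπ (by simp), .walk hlv (by simp)⟩))
  | @walk s s₀ lv t l hlv ht =>
    refine .inr (.inr (.inr ?_))
    rcases l with _ | ⟨⟨_ | _, c⟩, l⟩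
    · cases hs
    · cases hs
      exact ⟨lv, t, l, rfl, fun ht' => ⟨ht' ▸ .walkRecv _ _ _ _,
        (Base.Sim.walk hlv (by simp [ht'])).mode⟩⟩
    · cases hs

/-- Each step of the original process corresponds to a transition. -/
theorem Base.Sim.exists_trans {v : V} {q r q' : LocalState V} {b : Base V} {β : Action V}
    (h : Base.Sim G W v q r b) (hs : LocalStep q β q') :
    ∃ α m', Trans G W v ([], b) α (some β) m' ∧ m'.2.leaderValue = none ∧
      (β.IsLocal → α.IsLocal) ∧ (∀ w a, β = .send w a → α = .send w a.enc) ∧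
      ∀ w x a, β = .recv w x a → ∃ y, α = .recv w y a.enc := by
  cases h with
  | @run p s s₀ pv hp hsd hspv =>
    cases hs with
    | assign => exact ⟨_, _, .assign _ _ _, rfl, fun _ => trivial, by simp, by simp⟩
    | send => exact ⟨_, _, .send _ _ _, rfl, id, by simp, by simp⟩
    | recv => exact ⟨_, _, .recv _ _ _ _, rfl, id, by simp, by simp⟩
    | select => exact ⟨_, _, .guards _ _, rfl, fun _ => trivial, by simp, by simp⟩
    | repeat_ => exact ⟨_, _, .guards _ _, rfl, fun _ => trivial, by simp, by simp⟩
    | exit => exact ⟨_, _, .exit _, rfl, fun _ => trivial, by simp, by simp⟩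
  | @wait k g b p Z s s₀ pv O hb hp hsd hspv hO hex hZ =>
    cases hs with
    | choose => exact ⟨_, _, .choose _ _, rfl, fun _ => trivial, by simp, by simp⟩
    | guardSend _ _ _ _ _ i hc w e hi => exact ((hb i).1 _ _ hi).elim
    | guardRecv => exact ⟨_, _, .guardRecv _ _ _ _ _, rfl, id, by simp, by simp⟩
  | fwait => cases hs
  | walk => cases hs

/-- Each transition can be performed, provided that the original process can perform its part, and
that it has completed the election with the right leader value when the transition requires this. -/
theorem Mode.Sim.exists_of_trans {v : V} {q r q' : LocalState V} {m m' : Mode V} {α : Action V}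
    {β : Option (Action V)} (h : Mode.Sim G W v q r m) (ht : Trans G W v m α β m')
    (hβ : OptStep q β q') (hW : ∃ π ∈ W, π.head? = some v)
    (hlv : ∀ lv, m'.2.leaderValue = some lv → q'.Done ∧ q'.store .leader = lv) :
    ∃ r', LocalStep r α r' ∧ Mode.Sim G W v q' r' m' := by
  cases ht with
  | pending l b hα =>
    obtain ⟨r', h1, h2⟩ := h
    cases h1 with
    | cons _ hs _ hr =>
      obtain rfl : q' = q := hβ
      exact ⟨_, hs, _, hr, h2⟩
  | assign pv x a =>
    cases h.base with
    | @run p s s₀ _ hp hsd hspv =>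
      subst hsd
      cases hβ with
      | assign _ _ p _ =>
        exact ⟨_, .assign _ _ _ _, (Base.Sim.run (p := p) hp (by simp)
        (by simpa [Function.update_of_ne, Ne.symm] using hspv)).mode⟩
  | send pv w a =>
    cases h.base with
    | @run p s s₀ _ hp hsd hspv =>
      subst hsd
      cases hβ with
      | send _ _ p _ =>
        exact ⟨_, .send _ _ _ _, (Base.Sim.run (p := p) hp rfl hspv).mode⟩
  | recv pv w x a =>
    cases h.base with
    | @run p s s₀ _ hp hsd hspv =>
      subst hsd
      cases hβ with
      | recv _ _ p _ _ =>
        exact ⟨_, .recv _ _ _ _ _, (Base.Sim.run (p := p) hp (by simp)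
        (by simpa [Function.update_of_ne, Ne.symm] using hspv)).mode⟩
  | guards pv O =>
    cases h.base with
    | @run p s s₀ _ hp hsd hspv =>
      subst hsd
      cases hβ with
      | select k g b p _ hex =>
        refine ⟨_, ?_, (Base.Sim.wait (p := p) (Z := .select k (fun j => (g j).lift)
            (fun j => (g j).liftBody .done (b j).lift) .done) hp.1 hp.2 rfl hspv rfl hex
            fun _ => .inl rfl).mode⟩
        rw [← offers_lift]
        exact .select _ _ _ _ _ hex
      | repeat_ k g b p _ hex =>
        refine ⟨_, ?_, (Base.Sim.wait (p := .repeat_ k g b p) (Z := .done) hp.1 hp rfl hspv rfl hex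
            fun _ => .inr ⟨_, rfl, rfl⟩).mode⟩
        rw [← offers_lift]
        exact .repeat_ _ _ _ _ _ hex
  | exit pv =>
    cases h.base with
    | @run p s s₀ _ hp hsd hspv =>
      subst hsd
      cases hβ with
      | exit k g b p _ hex =>
        exact ⟨_, .exit _ _ _ _ _ hex, (Base.Sim.run (p := p) hp.2 rfl hspv).mode⟩
  | choose pv O =>
    cases h.base with
    | @wait k g b p Z s s₀ _ _ hb hp hsd hspv hO hex hZ =>
      subst hsd
      cases hβ with
      | choose _ _ _ _ _ i hc hi =>
        refine ⟨_, .choose _ _ _ _ _ i hc (by simp [Guard.lift, hi]), ?_⟩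
        have : (g i).liftBody Z (b i).lift = (b i).lift := by simp [Guard.liftBody, hi]
        rw [this, ← Prog.append_assoc, ← Prog.lift_append]
        exact (Base.Sim.run ((hb i).2.append hp) rfl hspv).mode
  | guardRecv pv O w x a =>
    cases h.base with
    | @wait k g b p Z s s₀ _ _ hb hp hsd hspv hO hex hZ =>
      subst hsd
      cases hβ with
      | guardRecv _ _ _ _ _ i hc _ _ hi =>
        have hs : LocalStep _ (.recv w tmpVar a.enc) _ := .guardRecv k (fun i => (g i).lift)
          (fun i => (g i).liftBody Z (b i).lift) (p.lift.append (traverse G W v)) s i hc w tmpVar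
          (by simp [Guard.lift, hi]) a.enc
        refine ⟨_, hs, ?_⟩
        have : (g i).liftBody Z (b i).lift = .screen Z x (b i).lift := by
          simp [Guard.liftBody, hi]
        rw [this]
        refine ⟨_, detRun_screen_enc (by simp), ?_⟩
        rw [← Prog.append_assoc, ← Prog.lift_append]
        exact .run ((hb i).2.append hp) (by simp)
          (by simpa [Function.update_of_ne, Ne.symm] using hspv)
  | @poll pv O w x π hpv hO' hπ =>
    obtain rfl : q' = q := hβ
    cases h.base with
    | @wait k g b p Z s s₀ _ _ hb hp hsd hspv hO hex hZ =>
      have hO'' := hO'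
      rw [hO] at hO''
      obtain ⟨i, hc, hi⟩ := hO''
      have hi' : (g i).comm = some (.input w x) := by
        rcases hg : (g i).comm with _ | ⟨w', y⟩ | ⟨w', e⟩ <;> simp [Guard.offer, hg] at hi
        rw [hi.1, hi.2]
      have hs : LocalStep _ (.recv w tmpVar (.token π)) _ := .guardRecv k (fun i => (g i).lift)
        (fun i => (g i).liftBody Z (b i).lift) (p.lift.append (traverse G W v)) s i
        (by simpa [Guard.lift, hsd] using hc) w tmpVar
        (by simp [Guard.lift, hi']) (.token π)
      have hsim := (Base.Sim.wait (G := G) (W := W) (v := v) hb hp hsd hspv hO hex hZ).mode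
      rcases hsim.of_recv_token hπ hs with h | ⟨pv, O, h, h'⟩ | ⟨_, _, h, _⟩ |
        ⟨_, _, _, h, _⟩
      · rcases h with ⟨_, _, h⟩ | ⟨_, _, h⟩ <;> cases h
      · cases h
        exact ⟨_, hs, (h' hpv).2⟩
      · cases h
      · cases h
  | @start pv lv hpv ho =>
    obtain rfl : q' = q := hβ
    obtain ⟨hd, rfl⟩ := hlv lv rfl
    cases h.base with
    | @run p s s₀ _ hp hsd hspv =>
      subst hsd hspv
      obtain rfl : p = .done := by simpa [LocalState.Done] using hd
      have hof := offers_tokenGuard (G := G) (W := W) (v := v) hpv (fun _ => hW)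
      refine ⟨_, ?_, (Base.Sim.fwait rfl rfl hpv).mode⟩
      rw [← hof] at ho ⊢
      obtain ⟨_, i, hi, -⟩ := ho
      exact .select _ _ _ _ _ ⟨i, hi⟩
  | @startPolled lv π hπ hlv' =>
    obtain rfl : q' = q := hβ
    obtain ⟨hd, rfl⟩ := hlv lv rfl
    cases h.base with
    | @run p s s₀ _ hp hsd hspv =>
      subst hsd
      obtain rfl : p = .done := by simpa [LocalState.Done] using hd
      cases detRun_traverse_polled (G := G) hπ hspv hlv' with
      | cons _ hs _ hr => exact ⟨_, hs, _, hr, .walk rfl hspv⟩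
  | @launch π hπ hv =>
    obtain rfl : q' = q := hβ
    cases h.base with
    | @fwait s s₀ _ hsd hlv' hspv =>
      subst hsd
      have := LocalStep.choose (Nat.card (W ⊕ Option V))
        (fun i => tokenGuard G W v ((Finite.equivFin (W ⊕ Option V)).symm i))
        (fun i => tokenBody W ((Finite.equivFin (W ⊕ Option V)).symm i)) (dispatch W v) s
        (Finite.equivFin _ (.inl ⟨π, hπ⟩)) (by simp [tokenGuard, hlv', hv]) (by simp [tokenGuard])
      rw [Equiv.symm_apply_apply] at this
      exact ⟨_, this, _, (detRun_assign planVar (fun _ => .token π) (dispatch W v) s).append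
            (detRun_dispatch hπ (by simp)), .walk hlv' (by simp)⟩
  | @receive lv w π hlv' hw hπ =>
    obtain rfl : q' = q := hβ
    cases h.base with
    | @fwait s s₀ _ hsd hlv'' hspv =>
      subst hsd hlv''
      have := LocalStep.guardRecv (Nat.card (W ⊕ Option V))
        (fun i => tokenGuard G W v ((Finite.equivFin (W ⊕ Option V)).symm i))
        (fun i => tokenBody W ((Finite.equivFin (W ⊕ Option V)).symm i)) (dispatch W v) s
        (Finite.equivFin _ (.inr (some w))) (by simp [tokenGuard, hlv', hw, hspv]) w planVar
        (by simp [tokenGuard, hw]) (.token π)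
      rw [Equiv.symm_apply_apply] at this
      exact ⟨_, this, _, detRun_dispatch hπ (by simp), .walk rfl (by simp)⟩
  | walkSend lv t b l =>
    obtain rfl : q' = q := hβ
    cases h.base with
    | @walk s s₀ _ _ _ hlv' ht =>
      subst ht
      exact ⟨_, .send _ _ _ _, (Base.Sim.walk hlv' rfl).mode⟩
  | walkRecv lv t a l =>
    obtain rfl : q' = q := hβ
    cases h.base with
    | @walk s s₀ _ _ _ hlv' ht =>
      exact ⟨_, .recv _ _ _ _ _, (Base.Sim.walk hlv' (by simp)).mode⟩

end Simulation

end CSP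

/-! ### Local traces and their renaming -/

namespace CSP

section Traces

variable {V : Type u} [DecidableEq V]

/-- How an action changes the value of the variable `leader`. -/
def leaderAfter {V : Type u} : Val V → Action V → Val V
  | _, .assign .leader a => a
  | _, .recv _ .leader a => a
  | b, _ => b

theorem LocalStep.leader_eq {q q' : LocalState V} {α : Action V} (h : LocalStep q α q') :
    q'.store .leader = leaderAfter (q.store .leader) α := by
  cases h with
  | assign x => cases x <;> simp [leaderAfter]
  | recv w x => cases x <;> simp [leaderAfter]
  | guardRecv k g b p s i hc w x => cases x <;> simp [leaderAfter]
  | _ => rfl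

theorem LocalRun.leader_eq {q q' : LocalState V} {h : List (Action V)} (r : LocalRun q h q') :
    q'.store .leader = h.foldl leaderAfter (q.store .leader) := by
  induction r with
  | nil => rfl
  | cons hs _ ih => rw [ih, hs.leader_eq, List.foldl_cons]

theorem leaderAfter_rename {V : Type u} (σ : V → V) (b : Val V) (α : Action V) :
    leaderAfter (b.rename σ) (α.rename σ) = (leaderAfter b α).rename σ := by
  cases α with
  | assign x => cases x <;> rfl
  | recv w x => cases x <;> rfl
  | _ => rfl

theorem foldl_leaderAfter_rename {V : Type u} (σ : V → V) (b : Val V) (h : List (Action V)) :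
    (h.map (Action.rename σ)).foldl leaderAfter (b.rename σ) =
      (h.foldl leaderAfter b).rename σ := by
  induction h generalizing b with
  | nil => rfl
  | cons α h ih => rw [List.map_cons, List.foldl_cons, List.foldl_cons, leaderAfter_rename, ih]

/-- `Translation G W v h h' m`: a sequence of transitions of process `v` leads to the mode `m`, by
the actions `h'` of the constructed system and `h` of the original one. -/
inductive Translation (G : Digraph V) (W : Set (List V)) (v : V) :
    List (Action V) → List (Action V) → Mode V → Prop
  | nil : Translation G W v [] [] ([], .run (.int 0))
  | snoc {h h' : List (Action V)} {m m' : Mode V} {α : Action V} {β : Option (Action V)} :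
      Translation G W v h h' m → Trans G W v m α β m' →
      Translation G W v (h ++ β.toList) (h' ++ [α]) m'

variable [Finite V] {G : Digraph V} {W : Set (List V)} [Finite W]

theorem Mode.Sim.initial {P : System V} (hP : P.InCSPin) (v : V) :
    Mode.Sim G W v (P.initState v) ((tokenSystem G W P).initState v) ([], .run (.int 0)) :=
  (Base.Sim.run (hP v) rfl rfl).mode

/-- The renamed trace of a process of the constructed system is a trace of the process with the
renamed name if this holds for the original system. -/
theorem Translation.exists_localRun {P : System V} (hP : P.InCSPin)
    (hW : ∀ v, ∃ π ∈ W, π.head? = some v) {σ : Equiv.Perm V} (hσ : IsAutomorphism G σ)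
    (hσW : ∀ π ∈ W, π.map σ ∈ W) {v : V} {h h' : List (Action V)} {m : Mode V}
    (ht : Translation G W v h h' m) {q : LocalState V}
    (hq : LocalRun (P.initState (σ v)) (h.map (Action.rename σ)) q)
    (hlv : ∀ lv, m.2.leaderValue = some lv → q.Done ∧ q.store .leader = lv.rename σ) :
    ∃ r, LocalRun ((tokenSystem G W P).initState (σ v)) (h'.map (Action.rename σ)) r ∧
      Mode.Sim G W (σ v) q r (m.rename σ) := by
  induction ht generalizing q with
  | nil =>
    cases hq
    exact ⟨_, .nil _, Mode.Sim.initial hP _⟩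
  | @snoc h h' m m' α β ht htr ih =>
    have key : ∃ q₀, LocalRun (P.initState (σ v)) (h.map (Action.rename σ)) q₀ ∧
        OptStep q₀ (β.map (Action.rename σ)) q ∧
        ∀ lv, m.2.leaderValue = some lv → q₀.Done ∧ q₀.store .leader = lv.rename σ := by
      cases β with
      | none => exact ⟨q, by simpa using hq, rfl, fun lv h => hlv lv (htr.leaderValue h)⟩
      | some β =>
        simp only [Option.toList_some, List.map_append, List.map_cons, List.map_nil] at hq
        obtain ⟨q₀, h1, h2⟩ := hq.of_snoc
        exact ⟨q₀, h1, h2, fun lv h => by rw [htr.leaderValue_eq_none.1] at h; cases h⟩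
    obtain ⟨q₀, h1, h2, h3⟩ := key
    obtain ⟨r₀, h4, h5⟩ := ih h1 h3
    obtain ⟨r, h6, h7⟩ := h5.exists_of_trans (htr.rename hσ hσW) h2 (hW _) (fun lv h => by
      change (m'.2.rename σ).leaderValue = some lv at h
      rw [Base.leaderValue_rename, Option.map_eq_some_iff] at h
      obtain ⟨lv, h, rfl⟩ := h
      exact hlv lv h)
    refine ⟨r, ?_, h7⟩
    rw [List.map_append]
    exact h4.snoc h6

end Traces

/-! ### The walk of the token -/

section Token

variable {V : Type u}

/-- A set of finite walks in `G` as needed for the token: some walk starts from each vertex, and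
each of them visits all vertices and traverses an edge between any two of them. -/
structure IsTourSet (G : Digraph V) (W : Set (List V)) : Prop where
  isChain : ∀ π ∈ W, π.IsChain G.Adj
  exists_head : ∀ v, ∃ π ∈ W, π.head? = some v
  mem : ∀ π ∈ W, ∀ v, v ∈ π
  consecutive : ∀ π ∈ W, ∀ a b, a ≠ b → [a, b] <:+: π ∨ [b, a] <:+: π

/-- The process has not been reached by the token. -/
def Base.Free : Base V → Prop
  | .run pv => pv = .int 0
  | .wait pv _ => pv = .int 0
  | .fwait _ => True
  | .walk _ _ _ => False

/-- The process has got the token `t` before it has completed the election, or before it has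
noticed that it has. -/
def Base.Holds (t : Val V) : Base V → Prop
  | .run pv => pv = t
  | .wait pv _ => pv = t
  | _ => False

/-- There has been a direct communication from `a` to `b`. -/
def Communicated (E : List (Event V)) (a b : V) : Prop :=
  ∃ x c, Event.comm a b x c ∈ E

theorem Communicated.append {E : List (Event V)} {a b : V} (h : Communicated E a b)
    (F : List (Event V)) : Communicated (E ++ F) a b := by
  obtain ⟨x, c, h⟩ := h
  exact ⟨x, c, List.mem_append_left _ h⟩

variable [DecidableEq V]

/-- The possible modes of process `v` when the token follows the walk `pre ++ a :: l` and has
arrived at `a`. -/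
inductive TokenAt (pre : List V) (a : V) (l : List V) : V → Mode V → Prop
  | polled {m : Mode V} (ha : a ∉ pre) (hpre : pre ≠ [])
      (hm : m.2.Holds (.token (pre ++ a :: l))) : TokenAt pre a l a m
  | active {m : Mode V} {lv : Val V}
      (hm : m.2 = .walk lv (.token (pre ++ a :: l)) (moves a (a :: l))) : TokenAt pre a l a m
  | visited {v : V} (lv : Val V) (hva : v ≠ a) (hv : v ∈ pre) :
      TokenAt pre a l v ([], .walk lv (.token (pre ++ a :: l)) (moves v (a :: l)))
  | unvisited {v : V} {m : Mode V} (hva : v ≠ a) (hv : v ∉ pre) (hm : m.2.Free) :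
      TokenAt pre a l v m

/-- The global situation of the token: there is none yet, or it is moving along a walk from the
elected leader, with a communication for each edge traversed so far. The last argument is a bound
for the number of moves that are to come; `B` is a bound for the lengths of the walks. -/
inductive TokenState (W : Set (List V)) (B : ℕ) (E : List (Event V)) (s : State V)
    (m : V → Mode V) : ℕ → Prop
  | idle (h : ∀ v, (m v).2.Free) : TokenState W B E s m (B + 1)
  | moving {pre : List V} {a : V} {l : List V} (hW : pre ++ a :: l ∈ W)
      (hlead : ∀ w, (pre ++ a :: l).head? = some w →
        (s w).Done ∧ (s w).store .leader = .name w)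
      (hm : ∀ v, TokenAt pre a l v (m v)) (hE : (pre ++ [a]).IsChain (Communicated E)) :
      TokenState W B E s m l.length

theorem moves_cons_of_ne {v a b : V} {l : List V} (ha : a ≠ v) (hb : b ≠ v) :
    moves v (a :: b :: l) = moves v (b :: l) := by
  simp [moves, ha, hb]

/-- A process that does not hold the token is not about to send it. -/
theorem moves_ne_of_ne {v a b : V} {l : List V} {l' : List (Bool × V)} (ha : v ≠ a) :
    moves v (a :: l) ≠ (true, b) :: l' := by
  induction l generalizing a with
  | nil => simp [moves]
  | cons c l ih =>
    by_cases hc : c = v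
    · simp [moves, ha.symm, hc]
    · rw [moves_cons_of_ne ha.symm hc]
      exact ih (Ne.symm hc)

theorem movesFrom_append {a : V} {pre l : List V} (ha : a ∉ pre) :
    movesFrom a (pre ++ a :: l) = moves a (a :: l) := by
  rw [movesFrom, List.dropWhile_append_of_pos]
  · simp
  · intro u hu
    simpa using fun h : u = a => ha (h ▸ hu)

theorem head_mem {V : Type u} {pre l : List V} {a w : V} (h : (pre ++ a :: l).head? = some w) :
    w ∈ pre ∨ (pre = [] ∧ w = a) := by
  cases pre with
  | nil => exact .inr ⟨rfl, by simpa using h.symm⟩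
  | cons b pre =>
    simp only [List.cons_append, List.head?_cons, Option.some.injEq] at h
    exact .inl (h ▸ List.mem_cons_self)

/-- The effect of a local step on the relation of a process to the token. -/
theorem Trans.token_of_isLocal {G : Digraph V} {W : Set (List V)} {v : V} {m m' : Mode V}
    {α : Action V} {β : Option (Action V)} (h : Trans G W v m α β m') (hα : α.IsLocal) :
    (m.2.Free → m'.2.Free ∨ ∃ π ∈ W, π.head? = some v ∧ m = ([], .fwait (.name v)) ∧
      m'.2 = .walk (.name v) (.token π) (movesFrom v π)) ∧
    (∀ π, m.2.Holds (.token π) → m'.2.Holds (.token π) ∨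
      ∃ lv, m'.2 = .walk lv (.token π) (movesFrom v π)) ∧
    (∀ lv t l, m.2 = .walk lv t l → m'.2 = .walk lv t l ∧ m.1 ≠ []) := by
  cases h with
  | pending l b hα => exact ⟨.inl, fun _ => .inl, fun _ _ _ h => ⟨h, by simp⟩⟩
  | assign pv x a => exact ⟨.inl, fun _ => .inl, by simp⟩
  | send pv w a => exact hα.elim
  | recv pv w x a => exact hα.elim
  | guards pv O => exact ⟨.inl, fun _ => .inl, by simp⟩
  | exit pv => exact ⟨.inl, fun _ => .inl, by simp⟩
  | choose pv O => exact ⟨.inl, fun _ => .inl, by simp⟩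
  | guardRecv pv O w x a => exact hα.elim
  | poll => exact hα.elim
  | @start pv lv hpv ho =>
    refine ⟨fun _ => .inl trivial, fun π h => ?_, by simp⟩
    obtain rfl : pv = _ := h
    simp at hpv
  | @startPolled lv π hπ hlv =>
    refine ⟨fun h => by simp [Base.Free, Val.token] at h, fun π' h => .inr ⟨lv, ?_⟩, by simp⟩
    obtain rfl := Val.token_injective h
    rfl
  | launch hπ hv => exact ⟨fun _ => .inr ⟨_, hπ, hv, rfl, rfl⟩, fun _ h => h.elim, by simp⟩
  | receive => exact hα.elim
  | walkSend => exact hα.elim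
  | walkRecv => exact hα.elim

/-- A bound for the number of the local steps that a process can perform before it performs a
communication or its original has to take a step. -/
def Mode.rank {V : Type u} (m : Mode V) : ℕ :=
  m.1.length + match m.2 with
    | .run _ => 5
    | _ => 0

theorem Trans.rank_lt {G : Digraph V} {W : Set (List V)} {v : V} {m m' : Mode V}
    {α : Action V} (h : Trans G W v m α none m') (hα : α.IsLocal) :
    Mode.rank m' < Mode.rank m ∨ (m.2.Free ∧ ¬ m'.2.Free) := by
  cases h with
  | pending l b hα => exact .inl (by simp [Mode.rank])
  | start => exact .inl (by simp [Mode.rank])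
  | startPolled => exact .inl (by simp [Mode.rank])
  | launch => exact .inr ⟨trivial, id⟩
  | poll => exact hα.elim
  | receive => exact hα.elim
  | walkSend => exact hα.elim
  | walkRecv => exact hα.elim

end Token

end CSP

/-! ### Global simulation -/

namespace CSP

section Token

variable {V : Type u} [DecidableEq V]

theorem Communicated.isChain_append {V : Type u} {E : List (Event V)} {l : List V}
    (h : l.IsChain (Communicated E)) (F : List (Event V)) :
    l.IsChain (Communicated (E ++ F)) :=
  h.imp fun _ _ h => h.append F

/-- Once the token has been launched, the only process that can ever consider itself elected is the
first vertex of the walk. -/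
theorem head_leader_unique {P : System V} (hP : P.IsElectoral) {F : List (Event V)} {s : State V}
    (hF : Run P.initState F s) {pre l : List V} {a v : V}
    (hlead : ∀ w, (pre ++ a :: l).head? = some w → (s w).Done ∧ (s w).store .leader = .name w)
    (hd : (s v).Done) (hv : (s v).store .leader = .name v) : v ∈ pre ∨ (pre = [] ∧ v = a) := by
  obtain ⟨w, hw⟩ : ∃ w, (pre ++ a :: l).head? = some w := by cases pre <;> simp
  obtain ⟨h1, h2⟩ := hlead w hw
  obtain rfl := hP.leader_unique hF h1 hd h2 hv
  exact head_mem hw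

/-- Communications of the election program do not affect the token. -/
theorem TokenState.unaffected {W : Set (List V)} {B : ℕ} {E : List (Event V)}
    {s s' : State V} {m m' : V → Mode V} {n : ℕ} (h : TokenState W B E s m n)
    (hs : ∀ w, (s w).Done → s' w = s w)
    (hm : ∀ v, m' v = m v ∨ ((m v).2.Free → (m' v).2.Free) ∧
      (∀ t, (m v).2.Holds t → (m' v).2.Holds t) ∧
      ((m v).2.Free ∨ ∃ t, (m v).2.Holds t)) (F : List (Event V)) :
    TokenState W B (E ++ F) s' m' n := by
  cases h with
  | idle h =>
    refine .idle fun v => ?_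
    rcases hm v with h' | ⟨h', -⟩
    · exact h' ▸ h v
    · exact h' (h v)
  | @moving pre a l hW hlead h hE =>
    refine .moving hW (fun w hw => ?_) (fun v => ?_) (Communicated.isChain_append hE F)
    · obtain ⟨h1, h2⟩ := hlead w hw
      rw [hs w h1]
      exact ⟨h1, h2⟩
    · rcases hm v with h' | ⟨h1, h2, h3⟩
      · exact h' ▸ h v
      · have hv := h v
        generalize m v = mv at *
        generalize m' v = mv' at *
        cases hv with
        | polled ha hpre hm => exact .polled ha hpre (h2 _ hm)
        | active hm =>
          rw [hm] at h3
          rcases h3 with h3 | ⟨t, h3⟩ <;> exact h3.elim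
        | visited lv hva hv => rcases h3 with h3 | ⟨t, h3⟩ <;> exact h3.elim
        | unvisited hva hv hm => exact .unvisited hva hv (h1 hm)

end Token

section Global

variable {V : Type u} [Fintype V] [DecidableEq V]

theorem sum_rank_update_lt {m : V → Mode V} {v : V} {x : Mode V} (h : x.rank < (m v).rank) :
    ∑ u, (Function.update m v x u).rank < ∑ u, (m u).rank := by
  refine Finset.sum_lt_sum (fun u _ => ?_) ⟨v, Finset.mem_univ _, by simpa using h⟩
  by_cases hu : u = v
  · subst hu
    simpa using h.le
  · simp [hu]

/-- The relation between the events `E` and the state `r` of the constructed system, the state `s`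
of the original system, the modes of the processes and the number of the moves to come. -/
structure Invariant (G : Digraph V) (W : Set (List V)) [Finite W] (P : System V) (B : ℕ)
    (E : List (Event V)) (r s : State V) (m : V → Mode V) (n : ℕ) : Prop where
  run : ∃ F, Run P.initState F s ∧ ∀ v, Translation G W v (hist v F) (hist v E) (m v)
  sim : ∀ v, Mode.Sim G W v (s v) (r v) (m v)
  token : TokenState W B E s m n

variable {G : Digraph V} {W : Set (List V)} [Finite W] {P : System V} {B : ℕ}

theorem Invariant.initial (hP : P.InCSPin) :
    Invariant G W P B [] (tokenSystem G W P).initState P.initState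
      (fun _ => ([], .run (.int 0))) (B + 1) where
  run := ⟨[], .nil _, fun _ => .nil⟩
  sim := Mode.Sim.initial hP
  token := .idle fun _ => rfl

/-- Passing from `(s, m, n)` to `(s', m', n')` makes progress: the original system takes a step, or
the token moves, or the rank decreases. -/
def Progress (s s' : State V) (m m' : V → Mode V) (n n' : ℕ) : Prop :=
  (∃ e, Step s e s') ∨ (s' = s ∧ (n' < n ∨ (n' = n ∧ ∑ v, (m' v).rank < ∑ v, (m v).rank)))

/-- A local step may launch the token, which can happen only once; otherwise the token stays where
it is, and the rank decreases unless the original process takes a step. -/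
theorem TokenState.of_isLocal (hP : P.IsElectoral) (hB : ∀ π ∈ W, π.length ≤ B)
    {E : List (Event V)} {r s s' : State V} {m : V → Mode V} {n : ℕ}
    {F : List (Event V)} (hF : Run P.initState F s) (h : TokenState W B E s m n)
    (hs : ∀ w, (s w).Done → s' w = s w) {v : V}
    (hsim : Mode.Sim G W v (s v) (r v) (m v)) {α : Action V} {β : Option (Action V)}
    {x : Mode V} (ht : Trans G W v (m v) α β x) (hα : α.IsLocal) (e : Event V) :
    ∃ n', TokenState W B (E ++ [e]) s' (Function.update m v x) n' ∧
      (β = none → n' < n ∨ (n' = n ∧ x.rank < (m v).rank)) := by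
  obtain ⟨ht1, ht2, ht3⟩ := ht.token_of_isLocal hα
  cases h with
  | idle h =>
    rcases ht1 (h v) with h1 | ⟨π, hπ, hv, hm, hx⟩
    · refine ⟨_, .idle fun u => ?_, fun hβ => .inr ⟨rfl, ?_⟩⟩
      · by_cases hu : u = v
        · subst hu
          simpa using h1
        · simpa [hu] using h u
      · subst hβ
        exact (ht.rank_lt hα).resolve_right fun h => h.2 h1
    · obtain ⟨l, rfl⟩ : ∃ l, π = v :: l := by
        cases π with
        | nil => simp at hv
        | cons a l => exact ⟨l, by simpa using hv⟩
      obtain ⟨hd, hlv⟩ := hsim.done_of_leaderValue (lv := .name v) (by rw [hm]; rfl)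
      refine ⟨l.length, .moving (pre := []) (a := v) hπ (fun w hw => ?_) (fun u => ?_)
        (.singleton _), fun _ => .inl ?_⟩
      · obtain rfl : v = w := by simpa using hw
        rw [hs v hd]
        exact ⟨hd, hlv⟩
      · by_cases hu : u = v
        · subst hu
          refine .active (lv := .name u) ?_
          rw [Function.update_self, hx, ← movesFrom_append (pre := []) (by simp)]
          rfl
        · exact .unvisited hu (by simp) (by simpa [hu] using h u)
      · have := hB _ hπ
        simp only [List.length_cons] at this
        omega
  | @moving pre a l hπ hlead h hE =>
    have hnl : ∀ hva : v ≠ a, v ∉ pre → (m v).2.Free → x.2.Free := fun hva hv hf => by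
      refine (ht1 hf).resolve_right ?_
      rintro ⟨π, -, -, hm, -⟩
      obtain ⟨hd, hlv⟩ := hsim.done_of_leaderValue (lv := .name v) (by rw [hm]; rfl)
      rcases head_leader_unique hP hF hlead hd hlv with h' | h'
      · exact hv h'
      · exact hva h'.2
    refine ⟨_, .moving hπ (fun w hw => ?_) (fun u => ?_) (Communicated.isChain_append hE _),
      fun hβ => .inr ⟨rfl, ?_⟩⟩
    · obtain ⟨h1, h2⟩ := hlead w hw
      rw [hs w h1]
      exact ⟨h1, h2⟩
    · by_cases hu : u = v
      · subst hu
        rw [Function.update_self]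
        have hv := h u
        generalize hmv : m u = mv at *
        cases hv with
        | polled ha hpre hm =>
          rcases ht2 _ hm with h' | ⟨lv, h'⟩
          · exact .polled ha hpre h'
          · rw [movesFrom_append ha] at h'
            exact .active h'
        | active hm => exact .active (ht3 _ _ _ hm).1
        | visited lv hva hv => exact ((ht3 _ _ _ rfl).2 rfl).elim
        | unvisited hva hv hm => exact .unvisited hva hv (hnl hva hv hm)
      · rw [Function.update_of_ne hu]
        exact h u
    · subst hβ
      refine (ht.rank_lt hα).resolve_right fun hf => ?_
      have hv := h v
      generalize hmv : m v = mv at *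
      cases hv with
      | polled ha hpre hm =>
        obtain ⟨l', b⟩ := mv
        cases b with
        | run pv => exact absurd (hf.1.symm.trans hm) (by simp [Val.token])
        | wait pv O => exact absurd (hf.1.symm.trans hm) (by simp [Val.token])
        | _ => exact hm
      | active hm =>
        rw [hm] at hf
        exact hf.1
      | visited lv hva hv => exact hf.1
      | unvisited hva hv hm => exact hf.2 (hnl hva hv hm)

/-- The invariant is preserved by each step, and each step makes progress. -/
theorem Invariant.step (hP : P.IsElectoral) (hW : IsTourSet G W)
    (hB : ∀ π ∈ W, π.length ≤ B) {E : List (Event V)} {r r' s : State V} {m : V → Mode V} {n : ℕ}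
    (h : Invariant G W P B E r s m n) {e : Event V} (hs : Step r e r') :
    ∃ s' m' n', Invariant G W P B (E ++ [e]) r' s' m' n' ∧ Progress s s' m m' n n' := by
  obtain ⟨F, hF, htr⟩ := h.run
  cases hs with
  | loc v α t hα hl =>
    have hpv : ∀ pv, m v = ([], .run pv) → (s v).Done → pv.isToken = true →
        (s v).store .leader ≠ .name v ∧ ∃ π ∈ W, pv = .token π := by
      intro pv hm hd hpv
      cases h.token with
      | idle h' =>
        have := h' v
        rw [hm] at this
        obtain rfl : pv = .int 0 := this
        cases hpv
      | @moving pre a l hπ hlead h' hE =>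
        have hv := h' v
        rw [hm] at hv
        cases hv with
        | polled ha hpre hh =>
          obtain rfl : pv = _ := hh
          refine ⟨fun hlv => ?_, _, hπ, rfl⟩
          rcases head_leader_unique hP hF hlead hd hlv with h' | h'
          · exact ha h'
          · exact hpre h'.1
        | active hh => cases hh
        | unvisited hva hv hh =>
          obtain rfl : pv = .int 0 := hh
          cases hpv
    obtain ⟨β, q', x, ht, hq, hβ, hx⟩ :=
      (h.sim v).exists_of_isLocal hpv (hW.exists_head v) hl hα
    have hstep : ∀ b, β = some b → Step s (.loc v b) (Function.update s v q') := by
      rintro b rfl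
      exact .loc s v b q' (hβ b rfl) hq
    have hnone : β = none → Function.update s v q' = s := by
      rintro rfl
      obtain rfl : q' = s v := hq
      exact Function.update_eq_self _ _
    have hdone : ∀ w, (s w).Done → Function.update s v q' w = s w := fun w hw => by
      cases β with
      | none => rw [hnone rfl]
      | some b => exact (hstep b rfl).eq_of_done hw
    obtain ⟨n', hn, hn'⟩ := h.token.of_isLocal hP hB hF hdone (h.sim v) ht hα (.loc v α)
    refine ⟨Function.update s v q', Function.update m v x, n', ⟨?_, fun u => ?_, hn⟩, ?_⟩
    · refine ⟨F ++ (β.map (Event.loc v)).toList, ?_, fun u => ?_⟩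
      · cases β with
        | none => simpa [hnone rfl] using hF
        | some b => exact hF.snoc (hstep b rfl)
      · rw [hist_append, hist_append]
        by_cases hu : u = v
        · subst hu
          rw [Function.update_self, hist_loc_self]
          have := (htr u).snoc ht
          cases β with
          | none => exact this
          | some b => simpa [hist_loc_self] using this
        · rw [Function.update_of_ne hu, hist_loc_of_ne hu]
          cases β with
          | none => simpa using htr u
          | some b => simpa [hist_loc_of_ne hu] using htr u
    · by_cases hu : u = v
      · subst hu
        simpa using hx
      · simpa [hu] using h.sim u
    · cases β with
      | none =>
        refine .inr ⟨hnone rfl, ?_⟩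
        rcases hn' rfl with h1 | ⟨h1, h2⟩
        · exact .inl h1
        · exact .inr ⟨h1, sum_rank_update_lt h2⟩
      | some b => exact .inl ⟨_, hstep b rfl⟩
  | comm v w y c t t' hvw hl hr =>
    rcases (h.sim v).of_send hl with ⟨pv, a, q, hmv, rfl, hq, hc, hsim⟩ | ⟨lv, ls, hmv, hsim⟩
    · -- a communication of the election program
      rcases (h.sim w).of_recv_enc hr with hd | ⟨z, q', pv', l, hmw, ht, hq', hsim'⟩
      · exact (hP.not_committedTo hF hd hc).elim
      have hst : Step s (.comm v w z a) (Function.update (Function.update s v q) w q') :=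
        .comm s v w z a q q' hvw hq hq'
      refine ⟨_, Function.update m w (l, .run pv'), n, ⟨⟨_, hF.snoc hst, fun u => ?_⟩,
        fun u => ?_, ?_⟩, .inl ⟨_, hst⟩⟩
      · rw [hist_append, hist_append]
        by_cases hu : u = w
        · subst hu
          rw [Function.update_self, hist_comm_right hvw, hist_comm_right hvw]
          exact (htr u).snoc ht
        · rw [Function.update_of_ne hu]
          by_cases hu' : u = v
          · subst hu'
            rw [hist_comm_left, hist_comm_left]
            have := htr u
            rw [hmv] at this ⊢
            exact this.snoc (.send pv w a)
          · rw [hist_comm_of_ne hu' hu, hist_comm_of_ne hu' hu]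
            simpa using htr u
      · by_cases hu : u = w
        · subst hu
          simpa using hsim'
        · rw [Function.update_of_ne hu, Function.update_of_ne hu, Function.update_of_ne hu]
          by_cases hu' : u = v
          · subst hu'
            simpa using hsim
          · simpa [hu'] using h.sim u
      · refine h.token.unaffected (fun u hu => hst.eq_of_done hu) (fun u => ?_) _
        by_cases hu : u = w
        · subst hu
          right
          rw [Function.update_self]
          have hb : (m u).2.Free ∨ ∃ t, (m u).2.Holds t := by
            rcases hmw with hm | ⟨O, hm⟩ <;> rw [hm] <;> exact .inr ⟨_, rfl⟩
          rcases hmw with hm | ⟨O, hm⟩ <;> rw [hm] at hb ht ⊢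
          · exact ⟨id, fun _ => id, hb⟩
          · cases ht
            exact ⟨id, fun _ => id, hb⟩
        · exact .inl (Function.update_of_ne hu _ _)
    · -- the token moves
      cases h.token with
      | idle h' =>
        have := h' v
        rw [hmv] at this
        exact this.elim
      | @moving pre a l hπ hlead hm hE =>
        have hv := hm v
        have key : v = a ∧ c = .token (pre ++ a :: l) ∧ (true, w) :: ls = moves a (a :: l) := by
          rw [hmv] at hv
          generalize hmg : (([], Base.walk lv c ((true, w) :: ls)) : Mode V) = mv at hv
          cases hv with
          | polled ha hpre hh => rw [← hmg] at hh; exact hh.elim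
          | active hh =>
            rw [← hmg] at hh
            simp only [Base.walk.injEq] at hh
            exact ⟨rfl, hh.2.1, hh.2.2⟩
          | visited lv' hva hv =>
            simp only [Prod.mk.injEq, Base.walk.injEq, true_and] at hmg
            exact (moves_ne_of_ne hva hmg.2.2.symm).elim
          | unvisited hva hv hh => rw [← hmg] at hh; exact hh.elim
        obtain ⟨rfl, rfl, hmoves⟩ := key
        obtain _ | ⟨b, l⟩ := l
        · simp [moves] at hmoves
        have hmoves' : moves v (v :: b :: l) = (true, b) :: moves v (b :: l) := by simp [moves]
        rw [hmoves'] at hmoves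
        simp only [List.cons.injEq, Prod.mk.injEq, true_and] at hmoves
        obtain ⟨rfl, rfl⟩ := hmoves
        have hd := (h.sim v).done_of_leaderValue (lv := lv) (by rw [hmv]; rfl)
        have happ : (pre ++ [v]) ++ w :: l = pre ++ v :: w :: l := by simp
        -- the new mode of the receiver, in which it holds the token
        have key : ∃ x, Trans G W w (m w) (.recv v y (.token (pre ++ v :: w :: l))) none x ∧
            Mode.Sim G W w (s w) t' x ∧ TokenAt (pre ++ [v]) w l w x := by
          have hwt := hm w
          rcases (h.sim w).of_recv_token hπ hr with hc | ⟨pv, O, hmw, h'⟩ | ⟨lv', l', hmw, h1, h2⟩ |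
            ⟨lv', t, l', hmw, h'⟩
          · exact (hP.not_committedTo hF hd.1 hc).elim
          · rw [hmw] at hwt h' ⊢
            cases hwt with
            | polled => exact (hvw rfl).elim
            | active => exact (hvw rfl).elim
            | unvisited hva hv hf =>
              obtain rfl : pv = .int 0 := hf
              obtain ⟨h1, h2⟩ := h' rfl
              refine ⟨_, h1, h2, .polled ?_ (by simp) ?_⟩
              · simp [hv, hvw.symm]
              · rw [happ]
                rfl
          · rw [hmw] at hwt
            cases hwt with
            | polled => exact (hvw rfl).elim
            | active => exact (hvw rfl).elim
            | unvisited hva hv hf =>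
              refine ⟨_, h1, h2, .active (lv := lv') ?_⟩
              rw [happ, ← movesFrom_append (pre := pre ++ [v]) (by simp [hv, hvw.symm]), happ]
          · rw [hmw] at hwt
            generalize hmg : (([], Base.walk lv' t ((false, v) :: l')) : Mode V) = mv at hwt
            cases hwt with
            | polled => exact (hvw rfl).elim
            | active => exact (hvw rfl).elim
            | visited lv'' hva hv =>
              simp only [Prod.mk.injEq, Base.walk.injEq, true_and] at hmg
              obtain ⟨rfl, rfl, hl'⟩ := hmg
              have : moves w (v :: w :: l) = (false, v) :: moves w (w :: l) := by
                simp [moves, hvw]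
              rw [this] at hl'
              obtain rfl := (List.cons.inj hl').2
              obtain ⟨h1, h2⟩ := h' rfl
              refine ⟨_, h1, h2, .active (lv := lv') ?_⟩
              rw [happ]
            | unvisited hva hv hf => rw [← hmg] at hf; exact hf.elim
        obtain ⟨x, ht, hsim', htok⟩ := key
        refine ⟨s, Function.update (Function.update m v ([], .walk lv
          (.token (pre ++ v :: w :: l)) (moves v (w :: l)))) w x, l.length,
          ⟨⟨F, hF, fun u => ?_⟩, fun u => ?_, ?_⟩, .inr ⟨rfl, .inl (by simp)⟩⟩
        · rw [hist_append]
          by_cases hu : u = w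
          · subst hu
            rw [Function.update_self, hist_comm_right hvw]
            simpa using (htr u).snoc ht
          · rw [Function.update_of_ne hu]
            by_cases hu' : u = v
            · subst hu'
              rw [hist_comm_left, Function.update_self]
              have := htr u
              rw [hmv] at this
              simpa using this.snoc (.walkSend _ _ _ _)
            · rw [hist_comm_of_ne hu' hu, Function.update_of_ne hu']
              simpa using htr u
        · by_cases hu : u = w
          · subst hu
            simpa using hsim'
          · rw [Function.update_of_ne hu, Function.update_of_ne hu]
            by_cases hu' : u = v
            · subst hu'
              simpa using hsim
            · simpa [hu'] using h.sim u
        · refine .moving (pre := pre ++ [v]) (happ ▸ hπ) (fun u hu => hlead u (happ ▸ hu))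
            (fun u => ?_) ?_
          · by_cases hu : u = w
            · subst hu
              simpa using htok
            · rw [Function.update_of_ne hu]
              by_cases hu' : u = v
              · subst hu'
                rw [Function.update_self, ← happ]
                exact .visited lv hu (by simp)
              · rw [Function.update_of_ne hu']
                have hut := hm u
                generalize m u = mu at hut
                cases hut with
                | polled => exact (hu' rfl).elim
                | active => exact (hu' rfl).elim
                | visited lv' hva hv =>
                  rw [moves_cons_of_ne hva.symm (Ne.symm hu), ← happ]
                  exact .visited lv' hu (by simp [hv])
                | unvisited hva hv hf => exact .unvisited hu (by simp [hv, hva]) hf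
          · refine List.IsChain.append (Communicated.isChain_append hE _) (.singleton w) ?_
            intro a ha b hb
            obtain rfl : v = a := by simpa using ha
            obtain rfl : w = b := by simpa using hb
            exact ⟨_, _, List.mem_append_right _ (List.mem_singleton_self _)⟩

theorem Invariant.of_run (hP : P.IsElectoral) (hW : IsTourSet G W)
    (hB : ∀ π ∈ W, π.length ≤ B) {E F : List (Event V)} {r r' s : State V} {m : V → Mode V} {n : ℕ}
    (h : Invariant G W P B E r s m n) (hr : Run r F r') :
    ∃ s' m' n', Invariant G W P B (E ++ F) r' s' m' n' := by
  induction hr generalizing E s m n with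
  | nil => exact ⟨s, m, n, by simpa using h⟩
  | cons hs _ ih =>
    obtain ⟨s', m', n', h', -⟩ := h.step hP hW hB hs
    obtain ⟨s'', m'', n'', h''⟩ := ih h'
    exact ⟨s'', m'', n'', by simpa using h''⟩

end Global

end CSP

/-! ### Termination -/

namespace CSP

section Termination

variable {V : Type u} [Fintype V] [DecidableEq V] {G : Digraph V} {W : Set (List V)} [Finite W]
  {P : System V} {B : ℕ}

/-- In a state of the constructed system that admits no step all processes have completed their
programs, and the token has traversed one of the walks. -/
theorem Invariant.of_not_step (hP : P.IsElectoral) (hG : IsNetwork G) (hW : IsTourSet G W)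
    (hin : ∀ v w : V, v ≠ w → ∃ u, G.Adj u v) {E : List (Event V)} {r s : State V}
    {m : V → Mode V} {n : ℕ} (h : Invariant G W P B E r s m n) (hr : ∀ e t, ¬ Step r e t) :
    (∀ v, (s v).Done ∧ (r v).Done ∧ ∃ lv t, m v = ([], .walk lv t [])) ∧
      ∃ π ∈ W, π.IsChain (Communicated E) := by
  obtain ⟨F, hF, -⟩ := h.run
  have hloc : ∀ v α q, α.IsLocal → ¬ LocalStep (r v) α q := fun v α q hα hl =>
    hr _ _ (.loc r v α q hα hl)
  have hnil : ∀ v, (m v).1 = [] := fun v => by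
    obtain ⟨r', h1, -⟩ := h.sim v
    cases hl : (m v).1 with
    | nil => rfl
    | cons α l =>
      rw [hl] at h1
      cases h1 with
      | cons hα hs => exact (hloc v _ _ hα hs).elim
  have hm : ∀ v, m v = ([], (m v).2) := fun v => Prod.ext (hnil v) rfl
  have hbase : ∀ v, Base.Sim G W v (s v) (r v) (m v).2 := fun v =>
    Mode.Sim.base (hm v ▸ h.sim v)
  have hlift : ∀ v β q, LocalStep (s v) β q → ∃ α q', LocalStep (r v) α q' ∧
      (β.IsLocal → α.IsLocal) ∧ (∀ w a, β = .send w a → α = .send w a.enc) ∧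
      ∀ w x a, β = .recv w x a → ∃ y, α = .recv w y a.enc := fun v β q hq => by
    obtain ⟨α, m', h1, h2, h3⟩ := (hbase v).exists_trans hq
    obtain ⟨q', h4, -⟩ := (hbase v).mode.exists_of_trans h1 hq (hW.exists_head v)
      fun lv hlv => by rw [h2] at hlv; cases hlv
    exact ⟨α, q', h4, h3⟩
  have hs : ∀ e t, ¬ Step s e t := by
    rintro e t (⟨v, α, q, hα, hl⟩ | ⟨v, w, x, a, q, q', hvw, hl, hl'⟩)
    · obtain ⟨α', q', h1, h2, -⟩ := hlift v α q hl
      exact hloc v _ _ (h2 hα) h1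
    · obtain ⟨α, t, h1, -, h2, -⟩ := hlift v _ _ hl
      obtain ⟨α', t', h1', -, -, h2'⟩ := hlift w _ _ hl'
      obtain rfl := h2 _ _ rfl
      obtain ⟨y, rfl⟩ := h2' _ _ _ rfl
      exact hr _ _ (.comm r v w y a.enc t t' hvw h1 h1')
  obtain ⟨hd, w, hw⟩ := hP.of_not_step hF hs
  -- a transition of a single process that does not involve the original process is impossible
  have hno : ∀ v mv α m', m v = mv → Trans G W v mv α none m' →
      (∀ lv, m'.2.leaderValue = some lv → lv = .name w) → ∃ q, LocalStep (r v) α q :=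
    fun v mv α m' hmv ht hlv => by
    obtain ⟨q, hq, -⟩ := (hmv ▸ h.sim v).exists_of_trans (q' := s v) ht rfl (hW.exists_head v)
      fun lv h' => ⟨hd v, (hw v).trans (hlv lv h').symm⟩
    exact ⟨q, hq⟩
  have hrun : ∀ v pv, m v = ([], .run pv) → pv ≠ .int 0 ∧
      ∀ π ∈ W, w ≠ v → pv ≠ .token π := by
    refine fun v pv hv => ⟨?_, ?_⟩
    · rintro rfl
      have ho : (startOffers G v (.name w)).Nonempty := by
        by_cases hvw : v = w
        · subst hvw
          exact ⟨none, .inl ⟨rfl, rfl⟩⟩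
        · obtain ⟨u, hu⟩ := hin v w hvw
          exact ⟨_, .inr ⟨fun h => hvw (Val.name.inj h).symm, u, hu, rfl⟩⟩
      obtain ⟨q, hq⟩ := hno v _ _ _ hv
        (Trans.start (pv := .int 0) rfl ho) (fun lv h => (Option.some.inj h).symm)
      refine hloc v _ q ?_ hq
      trivial
    · rintro π hπ hvw rfl
      obtain ⟨q, hq⟩ := hno v _ _ _ hv
        (Trans.startPolled (lv := .name w) hπ fun h => hvw (Val.name.inj h))
        (fun lv h => (Option.some.inj h).symm)
      refine hloc v _ q ?_ hq
      trivial
  have hwait : ∀ v pv O, m v ≠ ([], .wait pv O) := fun v pv O hv => by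
    have h1 := hbase v
    have h2 := hd v
    rw [hv] at h1
    generalize s v = q at h1 h2
    generalize r v = q' at h1
    cases h1
    cases h2
  have hfree : ∀ v, (m v).2.Free → m v = ([], .fwait (.name w)) := fun v hv => by
    have h1 := hm v
    cases hb : (m v).2 with
    | run pv =>
      rw [hb] at hv h1
      exact ((hrun v pv h1).1 hv).elim
    | wait pv O =>
      rw [hb] at h1
      exact (hwait v pv O h1).elim
    | fwait lv =>
      rw [hb] at h1
      obtain ⟨-, h2⟩ := (h.sim v).done_of_leaderValue (lv := lv) (by rw [h1]; rfl)
      rw [h1, ← h2, hw]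
    | walk =>
      rw [hb] at hv
      exact hv.elim
  cases h.token with
  | idle hf =>
    obtain ⟨π, hπ, hhead⟩ := hW.exists_head w
    obtain ⟨q, hq⟩ := hno w _ _ _ (hfree w (hf w)) (Trans.launch hπ hhead)
      (fun lv h => (Option.some.inj h).symm)
    refine (hloc w _ q ?_ hq).elim
    trivial
  | @moving pre a l hπ hlead htok hE =>
    have hhead : (pre ++ a :: l).head? = some w := by
      obtain ⟨w', hw'⟩ : ∃ w, (pre ++ a :: l).head? = some w := by cases pre <;> simp
      rw [hw', Val.name.inj ((hlead w' hw').2.symm.trans (hw w'))]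
    have ha : m a = ([], .walk (.name w) (.token (pre ++ a :: l)) (moves a (a :: l))) := by
      have h1 := hm a
      have h2 := htok a
      have h3 := hrun a
      have h4 := hwait a
      have h5 := fun lv (hlv : (m a).2.leaderValue = some lv) => (h.sim a).done_of_leaderValue hlv
      generalize m a = ma at *
      cases h2 with
      | polled hpre hne hh =>
        cases hb : ma.2 with
        | run pv =>
          rw [hb] at hh h1
          refine ((h3 pv h1).2 _ hπ ?_ hh).elim
          rintro rfl
          rcases head_mem hhead with h' | h'
          · exact hpre h'
          · exact hne h'.1
        | wait pv O =>
          rw [hb] at h1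
          exact (h4 pv O h1).elim
        | _ =>
          rw [hb] at hh
          exact hh.elim
      | @active _ lv hh =>
        have := (h5 lv (by rw [hh]; rfl)).2
        rw [h1, hh, ← this, hw]
      | visited _ hva => exact (hva rfl).elim
      | unvisited hva => exact (hva rfl).elim
    cases l with
    | nil =>
      have hall : ∀ v, ∃ lv t, m v = ([], .walk lv t []) := fun v => by
        by_cases hva : v = a
        · subst hva
          exact ⟨_, _, ha⟩
        · have hv := htok v
          generalize m v = mv at *
          cases hv with
          | polled => exact (hva rfl).elim
          | active => exact (hva rfl).elim
          | visited lv => exact ⟨lv, _, rfl⟩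
          | unvisited _ hv =>
            have := hW.mem _ hπ v
            simp only [List.mem_append, List.mem_singleton] at this
            exact (this.elim hv hva).elim
      refine ⟨fun v => ⟨hd v, ?_, hall v⟩, _, hπ, hE⟩
      obtain ⟨lv, t, hv⟩ := hall v
      have h1 := hbase v
      rw [hv] at h1
      generalize s v = q at h1
      generalize r v = q' at h1
      cases h1
      rfl
    | cons b l =>
      have hmoves : moves a (a :: b :: l) = (true, b) :: moves a (b :: l) := by simp [moves]
      rw [hmoves] at ha
      have hchain := hW.isChain _ hπ
      have hab : G.Adj a b := by
        have := (List.isChain_append.1 hchain).2.1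
        exact (List.isChain_cons_cons.1 this).1
      have hne : a ≠ b := fun h => hG a (by rw [← h] at hab; exact hab)
      obtain ⟨q, hq⟩ := hno a _ _ _ ha (Trans.walkSend _ _ _ _)
        (fun lv h => (Option.some.inj h).symm)
      have hrecv : ∃ x q', LocalStep (r b) (.recv a x (.token (pre ++ a :: b :: l))) q' := by
        have hb := htok b
        generalize hmb : m b = mb at *
        cases hb with
        | polled => exact (hne rfl).elim
        | active => exact (hne rfl).elim
        | visited lv hva hv =>
          have h1 : moves b (a :: b :: l) = (false, a) :: moves b (b :: l) := by
            simp [moves, hne]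
          rw [h1] at hmb
          have h2 := (h.sim b).done_of_leaderValue (lv := lv) (by rw [hmb]; rfl)
          obtain ⟨q', hq'⟩ := hno b _ _ _ hmb (Trans.walkRecv _ _ _ _)
            (fun lv' h => (Option.some.inj h).symm.trans (h2.2.symm.trans (hw b)))
          exact ⟨_, q', hq'⟩
        | unvisited hva hv hf =>
          have h1 := hfree b (hmb ▸ hf)
          have hwb : w ≠ b := by
            rintro rfl
            rcases head_mem hhead with h' | h'
            · exact hv h'
            · exact hva h'.2
          obtain ⟨q', hq'⟩ := hno b _ _ _ h1
            (Trans.receive (fun h => hwb (Val.name.inj h)) hab hπ)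
            (fun lv h => (Option.some.inj h).symm)
          exact ⟨_, q', hq'⟩
      obtain ⟨x, q', hq'⟩ := hrecv
      exact (hr _ _ (.comm r a b x _ q q' hne hq hq')).elim

/-- Each computation of the constructed system is finite. -/
theorem exists_event_eq_none (hP : P.IsElectoral) (hW : IsTourSet G W)
    (hB : ∀ π ∈ W, π.length ≤ B) (C : Computation (tokenSystem G W P)) {s : State V}
    (hs : Acc (fun t s => ∃ e, Step s e t) s) {k : ℕ} {m : V → Mode V} {n : ℕ}
    (h : Invariant G W P B (C.events k) (C.state k) s m n) : ∃ k, C.event k = none := by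
  induction hs generalizing k m n with
  | intro s _ ih =>
    induction n using Nat.strong_induction_on generalizing k m with
    | _ n ihn =>
      induction hR : ∑ v, (m v).rank using Nat.strong_induction_on generalizing k m with
      | _ R ihR =>
        cases he : C.event k with
        | none => exact ⟨k, he⟩
        | some e =>
          obtain ⟨s', m', n', h', hp⟩ := h.step hP hW hB (C.step k e he)
          have hev : C.events k ++ [e] = C.events (k + 1) := by
            rw [C.events_succ, he]
            rfl
          rw [hev] at h'
          rcases hp with hp | ⟨rfl, hp | ⟨rfl, hp⟩⟩
          · exact ih s' hp h'
          · exact ihn n' hp h'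
          · exact ihR _ (hR ▸ hp) h' rfl

end Termination

/-! ### Walks -/

section Tours

variable {V : Type u} {G : Digraph V}

/-- In a strongly connected digraph there is a walk that traverses any given edges. -/
theorem StronglyConnected.exists_walk (hG : StronglyConnected G) (l : List (V × V))
    (hl : ∀ e ∈ l, G.Adj e.1 e.2) (w : V) : ∃ π : List V, π.head? = some w ∧ π.IsChain G.Adj ∧
      ∀ e ∈ l, [e.1, e.2] <:+: π := by
  induction l generalizing w with
  | nil => exact ⟨[w], rfl, .singleton w, by simp⟩
  | cons e l ih =>
    obtain ⟨a, b⟩ := e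
    obtain ⟨p, hp, hlast⟩ := List.exists_isChain_cons_of_relationReflTransGen (hG w a)
    obtain ⟨π, h1, h2, h3⟩ := ih (fun e he => hl e (List.mem_cons_of_mem _ he)) b
    obtain ⟨π, rfl⟩ : ∃ π', π = b :: π' := by
      cases π with
      | nil => simp at h1
      | cons c π => exact ⟨π, by simpa using h1⟩
    have hlast' : (w :: p).getLast? = some a := by
      rw [List.getLast?_eq_getLast_of_ne_nil (by simp), hlast]
    refine ⟨(w :: p) ++ b :: π, rfl, hp.append h2 ?_, ?_⟩
    · intro x hx y hy
      rw [hlast'] at hx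
      obtain rfl : a = x := by simpa using hx
      obtain rfl : b = y := by simpa using hy
      exact hl _ List.mem_cons_self
    · intro e he
      rcases List.mem_cons.1 he with rfl | he
      · obtain ⟨p', hp'⟩ := List.getLast?_eq_some_iff.1 hlast'
        exact ⟨p', π, by rw [hp']; simp⟩
      · exact (h3 e he).trans (List.suffix_append _ _).isInfix

/-- Walks of bounded length that traverse an edge between any two vertices. -/
def tours (G : Digraph V) (B : ℕ) : Set (List V) :=
  {π | π.length ≤ B ∧ π ≠ [] ∧ π.IsChain G.Adj ∧
    ∀ a b, a ≠ b → [a, b] <:+: π ∨ [b, a] <:+: π}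

theorem finite_tours [Finite V] (B : ℕ) : (tours G B).Finite :=
  (List.finite_length_le V B).subset fun _ h => h.1

theorem map_mem_tours {σ : Equiv.Perm V} (hσ : IsAutomorphism G σ) {B : ℕ} {π : List V}
    (h : π ∈ tours G B) : π.map σ ∈ tours G B := by
  obtain ⟨h1, h2, h3, h4⟩ := h
  refine ⟨by simpa using h1, by simpa using h2, ?_, fun a b hab => ?_⟩
  · rw [List.isChain_map]
    exact h3.imp fun a b => hσ a b
  · obtain ⟨a, rfl⟩ := σ.surjective a
    obtain ⟨b, rfl⟩ := σ.surjective b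
    exact (h4 a b fun h => hab (h ▸ rfl)).imp (fun h => by simpa using h.map σ)
      (fun h => by simpa using h.map σ)

/-- For each vertex take a walk from it that traverses all edges; the sum of the lengths of these
walks serves as the bound. -/
theorem exists_isTourSet [Finite V] (hG : StronglyConnected G) (hd : DirectlyConnected G) :
    ∃ B, IsTourSet G (tours G B) := by
  classical
  have := Fintype.ofFinite V
  choose π h1 h2 h3 using hG.exists_walk
    (Finset.univ.filter fun e : V × V => G.Adj e.1 e.2).toList (by simp)
  refine ⟨∑ v, (π v).length, fun π h => h.2.2.1, fun v => ⟨π v, ⟨?_, ?_, h2 v, fun a b hab => ?_⟩,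
    h1 v⟩, fun π hπ v => ?_, fun π h => h.2.2.2⟩
  · exact Finset.single_le_sum (f := fun v => (π v).length) (fun _ _ => Nat.zero_le _)
      (Finset.mem_univ v)
  · rintro h
    have := h1 v
    rw [h] at this
    cases this
  · exact (hd a b hab).imp (fun h => h3 v (a, b) (by simpa using h))
      (fun h => h3 v (b, a) (by simpa using h))
  · obtain ⟨-, hne, -, h⟩ := hπ
    cases π with
    | nil => exact (hne rfl).elim
    | cons w π =>
      by_cases hvw : v = w
      · exact hvw ▸ List.mem_cons_self
      · rcases h v w hvw with h | h <;> exact h.subset (by simp)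

end Tours

end CSP

/-! ### The constructed system -/

namespace CSP

section Final

variable {V : Type u} [Fintype V] [DecidableEq V] {G : Digraph V} {W : Set (List V)} [Finite W]
  {P : System V} {B : ℕ}

theorem tokenSystem_synchronizes (hP : P.IsElectoral) (hP' : P.InCSPin) (hG : IsNetwork G)
    (hW : IsTourSet G W) (hB : ∀ π ∈ W, π.length ≤ B)
    (hin : ∀ v w : V, v ≠ w → ∃ u, G.Adj u v) :
    (tokenSystem G W P).Synchronizes Set.univ := by
  intro C
  obtain ⟨k, hk⟩ := exists_event_eq_none (k := 0) hP hW hB C (hP.acc (.nil _))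
    (by rw [C.init]; exact Invariant.initial hP')
  obtain ⟨s, m, n, hinv⟩ := (Invariant.initial hP').of_run hP hW hB (C.run k)
  obtain ⟨hd, π, hπ, hπE⟩ := hinv.of_not_step hP hG hW hin (C.halt k hk).2
  refine ⟨⟨k, hk, fun v => (hd v).2.1⟩, fun a _ b _ hab => ?_⟩
  have hev : ∀ a b, [a, b] <:+: π → ∃ n x c, C.event n = some (.comm a b x c) := fun a b h => by
    obtain ⟨x, c, hc⟩ := (List.isChain_cons_cons.1 (hπE.infix h)).1
    simp only [Computation.events, List.nil_append, List.mem_filterMap] at hc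
    obtain ⟨n, -, hn⟩ := hc
    exact ⟨n, x, c, hn⟩
  rcases hW.consecutive π hπ a b hab with h | h
  · obtain ⟨n, x, c, h⟩ := hev a b h
    exact ⟨n, x, c, .inl h⟩
  · obtain ⟨n, x, c, h⟩ := hev b a h
    exact ⟨n, x, c, .inr h⟩

/-- The renamed traces of a completed run lead to completion: the renamed modes say that no moves
remain. -/
theorem tokenSystem_symmetric (hP : P.IsElectoral) (hP' : P.InCSPin) (hS : P.Symmetric G)
    (hG : IsNetwork G) (hW : IsTourSet G W) (hB : ∀ π ∈ W, π.length ≤ B)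
    (hin : ∀ v w : V, v ≠ w → ∃ u, G.Adj u v)
    (hσW : ∀ σ : Equiv.Perm V, IsAutomorphism G σ → ∀ π ∈ W, π.map σ ∈ W) :
    (tokenSystem G W P).Symmetric G := by
  refine System.symmetric_of_localRun
    (fun C => (tokenSystem_synchronizes hP hP' hG hW hB hin C).1) fun σ hσ E r hr hd v => ?_
  obtain ⟨s, m, n, hinv⟩ := (Invariant.initial hP').of_run hP hW hB hr
  obtain ⟨hfin, -⟩ := hinv.of_not_step hP hG hW hin fun _ _ => not_step_of_done hd
  obtain ⟨F, hF, htr⟩ := hinv.run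
  obtain ⟨q, hqd, hq⟩ := hS.exists_localRun hP hσ hF (fun v => (hfin v).1) v
  obtain ⟨-, -, lv, t, hm⟩ := hfin v
  have hlead : q.store .leader = ((s v).store .leader).rename σ := by
    rw [hq.leader_eq, (hF.localRun v).leader_eq]
    exact foldl_leaderAfter_rename σ (.int 0) _
  obtain ⟨r', h1, h2⟩ := (htr v).exists_localRun hP' hW.exists_head hσ (hσW σ hσ) hq
    (fun lv' hlv => ⟨hqd, by rw [hlead, ((hinv.sim v).done_of_leaderValue hlv).2]⟩)
  refine ⟨r', ?_, h1⟩
  rw [hm] at h2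
  have h3 : Base.Sim G W (σ v) q r' (.walk (lv.rename σ) (t.rename σ) []) := Mode.Sim.base h2
  cases h3
  rfl

end Final

end CSP

theorem mainTheorem3 {V : Type*} [Finite V] [DecidableEq V] (G : Digraph V)
    (hG : CSP.IsNetwork G)
    (hstrong : CSP.StronglyConnected G)
    (hdirect : CSP.DirectlyConnected G)
    (helect : ∃ P : CSP.System V, P.AdmittedBy G ∧ P.InCSPin ∧ P.Symmetric G ∧ P.IsElectoral)
    (hcentre : ∃ v, ∀ a, a ≠ v → G.Adj v a ∧ G.Adj a v) :
    ∃ Q : CSP.System V, Q.AdmittedBy G ∧ Q.InCSPin ∧ Q.Symmetric G ∧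
      Q.Synchronizes Set.univ := by
  have := Fintype.ofFinite V
  obtain ⟨P, hadm, hP', hS, hP⟩ := helect
  obtain ⟨B, hW⟩ := CSP.exists_isTourSet hstrong hdirect
  have hfin : Finite (CSP.tours G B) := CSP.finite_tours B
  have hB : ∀ π ∈ CSP.tours G B, π.length ≤ B := fun π h => h.1
  have hin : ∀ v w : V, v ≠ w → ∃ u, G.Adj u v := fun v w hvw => by
    rcases Relation.ReflTransGen.cases_tail (hstrong w v) with h | ⟨u, -, hu⟩
    · exact (hvw h).elim
    · exact ⟨u, hu⟩
  exact ⟨CSP.tokenSystem G (CSP.tours G B) P, CSP.tokenSystem_admittedBy hadm hW.isChain,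
    CSP.tokenSystem_inCSPin hP',
    CSP.tokenSystem_symmetric hP hP' hS hG hW hB hin fun σ hσ π h => CSP.map_mem_tours hσ h,
    CSP.tokenSystem_synchronizes hP hP' hG hW hB hin⟩
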